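/- Let $k,k'\in\mathbb C$ with $k^2+k'^2=1$ and $k'\neq0$. A rapidity $\mathrm p$ of modulus $k$ is given by complex numbers $\theta_{\mathrm p},\phi_{\mathrm p},\gamma_{\mathrm p}$ such that, with $\lambda_{\mathrm p}=(\theta_{\mathrm p}+\phi_{\mathrm p})/2\pi$, $$e^{i\phi_{\mathrm p}}\,(1+k e^{i\theta_{\mathrm p}})=e^{i\theta_{\mathrm p}}+k,\qquad e^{\gamma_{\mathrm p}\pm\pi i\lambda_{\mathrm p}}=\frac{e^{\pm i\theta_{\mathrm p}}+k}{k'} .$$ Let $\mathrm p,\mathrm q,\mathrm r$ be rapidities of the same modulus $k$ (and the same $k'$) in the principal domain $$0<\Re(\lambda_{\mathrm q}-\lambda_{\mathrm p}),\qquad 0<\Re(\lambda_{\mathrm r}-\lambda_{\mathrm q}),\qquad \Re(\lambda_{\mathrm r}-\lambda_{\mathrm p})<1 .$$ For real $x$, with $\{\cdot\}$ the fractional part, define for each pair, as for $\mathrm{pq}$, $$W_{\mathrm{pq}}(x)=e^{(\gamma_{\mathrm p}-\gamma_{\mathrm q})\{x/2\pi\}}\,|\sin\tfrac12x|^{\lambda_{\mathrm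 p}-\lambda_{\mathrm q}},\qquad \overline W_{\mathrm{pq}}(x)=e^{(\gamma_{\mathrm p}+\gamma_{\mathrm q})\{x/2\pi\}}\,|\sin\tfrac12x|^{\lambda_{\mathrm q}-\lambda_{\mathrm p}-1},$$ $$\overline\alpha_{\mathrm{pq}}=\frac{\phi_{\mathrm q}-\phi_{\mathrm p}}{2\pi},\quad \overline\beta_{\mathrm{pq}}=1+\frac{\theta_{\mathrm p}-\theta_{\mathrm q}}{2\pi},\quad \tilde f_{\mathrm{pq}}=\frac{\Gamma(\overline\alpha_{\mathrm{pq}})\Gamma(1-\overline\alpha_{\mathrm{pq}})}{\pi\,\Gamma(\overline\beta_{\mathrm{pq}}-\overline\alpha_{\mathrm{pq}})},\quad R^\infty_{\mathrm{pqr}}=\frac{\tilde f_{\mathrm{pq}}\tilde f_{\mathrm{qr}}}{\tilde f_{\mathrm{pr}}} .$$ Then the six weights $W,\overline W$ of the pairs $\mathrm{pq},\mathrm{qr},\mathrm{pr}$ are $2\pi$-periodic and integrable over a period, $R^\infty_{\mathrm{pqr}}\neq0$, and: (1) For all real $x,y,z$ with $x-y,\ y-z,\ x-z\notin2\pi\mathbb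 Z$, the following integrand is integrable and $$\frac1{2\pi}\int_0^{2\pi}\overline W_{\mathrm{qr}}(y-w)\,W_{\mathrm{pr}}(x-w)\,\overline W_{\mathrm{pq}}(w-z)\,dw=R^\infty_{\mathrm{pqr}}\,W_{\mathrm{pq}}(x-y)\,\overline W_{\mathrm{pr}}(y-z)\,W_{\mathrm{qr}}(x-z).$$ (2) The Fourier coefficients $W^{(f)}(j)=\frac1{2\pi}\int_0^{2\pi}e^{-ijx}W(x)\,dx$ and $\overline W^{(f)}(j)=\frac1{2\pi}\int_0^{2\pi}e^{-ijx}\,\overline W(x)\,dx$, $j\in\mathbb Z$, satisfy for all $a,b,c\in\mathbb Z$ $$\frac1{R^\infty_{\mathrm{pqr}}}\,\overline W^{(f)}_{\mathrm{qr}}(a-b)\,W^{(f)}_{\mathrm{pr}}(b-c)\,\overline W^{(f)}_{\mathrm{pq}}(a-c)=\sum_{d=-\infty}^{\infty}W^{(f)}_{\mathrm{pq}}(b-d)\,\overline W^{(f)}_{\mathrm{pr}}(a-d)\,W^{(f)}_{\mathrm{qr}}(d-c),$$ where the series converges absolutely. -/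

import Mathlib

open MeasureTheory

namespace ChiralPotts

/-- A rapidity of modulus `k`, with complementary modulus `k'` (a square root of `1 - k ^ 2`):
complex numbers `θ`, `φ`, `γ` with
`e^{iφ} = (e^{iθ} + k) / (1 + k e^{iθ})` and `e^{γ ± πiλ} = (e^{±iθ} + k) / k'`,
where `λ = (θ + φ) / (2π)`. -/
structure Rapidity (k k' : ℂ) where
  θ : ℂ
  φ : ℂ
  γ : ℂ
  curve : Complex.exp (Complex.I * φ) * (1 + k * Complex.exp (Complex.I * θ)) =
    Complex.exp (Complex.I * θ) + k
  exp_gamma_add : Complex.exp (γ + Real.pi * Complex.I * ((θ + φ) / (2 * Real.pi))) =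
    (Complex.exp (Complex.I * θ) + k) / k'
  exp_gamma_sub : Complex.exp (γ - Real.pi * Complex.I * ((θ + φ) / (2 * Real.pi))) =
    (Complex.exp (-(Complex.I * θ)) + k) / k'

variable {k k' : ℂ}

/-- `λ_p = (θ_p + φ_p) / (2π)`. -/
noncomputable def Rapidity.lam (p : Rapidity k k') : ℂ := (p.θ + p.φ) / (2 * Real.pi)

/-- `W_pq(x) = e^{(γ_p - γ_q) {x/2π}} |sin(x/2)|^{λ_p - λ_q}`, with `{t}` the fractional part. -/
noncomputable def W (p q : Rapidity k k') (x : ℝ) : ℂ :=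
  Complex.exp ((p.γ - q.γ) * (Int.fract (x / (2 * Real.pi)) : ℝ)) *
    ((|Real.sin (x / 2)| : ℝ) : ℂ) ^ (p.lam - q.lam)

/-- `W̄_pq(x) = e^{(γ_p + γ_q) {x/2π}} |sin(x/2)|^{λ_q - λ_p - 1}`. -/
noncomputable def Wbar (p q : Rapidity k k') (x : ℝ) : ℂ :=
  Complex.exp ((p.γ + q.γ) * (Int.fract (x / (2 * Real.pi)) : ℝ)) *
    ((|Real.sin (x / 2)| : ℝ) : ℂ) ^ (q.lam - p.lam - 1)

/-- `ᾱ_pq = (φ_q - φ_p) / (2π)`. -/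
noncomputable def alphaBar (p q : Rapidity k k') : ℂ := (q.φ - p.φ) / (2 * Real.pi)

/-- `β̄_pq = 1 + (θ_p - θ_q) / (2π)`. -/
noncomputable def betaBar (p q : Rapidity k k') : ℂ := 1 + (p.θ - q.θ) / (2 * Real.pi)

/-- `f̃_pq = Γ(ᾱ_pq) Γ(1 - ᾱ_pq) / (π Γ(β̄_pq - ᾱ_pq))`. -/
noncomputable def fTilde (p q : Rapidity k k') : ℂ :=
  Complex.Gamma (alphaBar p q) * Complex.Gamma (1 - alphaBar p q) /
    (Real.pi * Complex.Gamma (betaBar p q - alphaBar p q))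

/-- `R^∞_pqr = f̃_pq f̃_qr / f̃_pr`. -/
noncomputable def Rinf (p q r : Rapidity k k') : ℂ := fTilde p q * fTilde q r / fTilde p r

/-- The Fourier coefficient `(1/2π) ∫₀^{2π} e^{-ijx} f(x) dx`. -/
noncomputable def fourierTransform (f : ℝ → ℂ) (j : ℤ) : ℂ :=
  (1 / (2 * Real.pi)) *
    ∫ x in (0 : ℝ)..(2 * Real.pi), Complex.exp (-(Complex.I * j * x)) * f x

end ChiralPotts

/-! Star-triangle. The exponents of the three chord factors on the left add up to `-2`, and in the
exponential prefactor the coefficient of `w` cancels, so the prefactor is constant on each of the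
three arcs cut out by `x`, `y`, `z`. A product of chord powers of total degree `-2` is Möbius
covariant: a cross-ratio coordinate turns each arc integral into a Beta integral, with the same
chord prefactor on all three (`arc_integral`, `three_arc_integral`). By the reflection formula the
three Beta values share one triple Gamma product and differ only in a sine. What remains is a sum of
three sines weighted by exponentials of the `γ`'s. Written in `e^{iθ}` by means of the rapidity
equations, it factorises (`arcSum_cleared`), which yields `Rinf` (`Gamma_mul_arcSum`). The other
cyclic order of the points gives the same sum up to the phase jump of `W p q` (`arcSum_swap`).

Dual identity. With `z = 0`, both sides are multiplied by characters in `x` and `y` and integrated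
over the torus. The left side factors into three Fourier coefficients by translation. The right side
has the form `f (x - y) * g y * h x`; integrating over `x` first leaves a correlation whose Fourier
coefficients are products of those of `f` and `h`. Integration by parts gives a two-term recurrence
for the coefficients, hence power decay (`chordIntegral_recurrence`, `isBigO_of_recurrence`). The
product is summable exactly because `Re (λ_r - λ_p) < 1`. The correlation therefore equals its
uniformly convergent Fourier series almost everywhere and can be integrated term by term against the
merely integrable `g` (`hasSum_fourierCoeff_triple`, `hasSum_dual`). -/

namespace ChiralPotts

/-! ### Chord powers on the circle and Beta integrals over arcs -/

open Set

/-- The half-chord `|sin (t / 2)|` between two points of the unit circle at angle `t`. -/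
noncomputable def chord (t : ℝ) : ℝ := |Real.sin (t / 2)|

lemma chord_nonneg (t : ℝ) : 0 ≤ chord t := abs_nonneg _

lemma chord_neg (t : ℝ) : chord (-t) = chord t := by
  simp [chord, neg_div]

lemma chord_sub_comm (s t : ℝ) : chord (s - t) = chord (t - s) := by
  rw [← chord_neg, neg_sub]

lemma chord_periodic : Function.Periodic chord (2 * Real.pi) := by
  intro t
  have : (t + 2 * Real.pi) / 2 = t / 2 + Real.pi := by ring
  simp [chord, this]

lemma chord_eq_sin {t : ℝ} (h0 : 0 ≤ t) (h1 : t ≤ 2 * Real.pi) : chord t = Real.sin (t / 2) :=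
  abs_of_nonneg (Real.sin_nonneg_of_nonneg_of_le_pi (by linarith) (by linarith))

lemma sin_half_pos {t : ℝ} (h0 : 0 < t) (h1 : t < 2 * Real.pi) : 0 < Real.sin (t / 2) :=
  Real.sin_pos_of_pos_of_lt_pi (by linarith) (by linarith)

lemma betaIntegral_integrableOn {u v : ℂ} (hu : 0 < u.re) (hv : 0 < v.re) :
    IntegrableOn (fun x : ℝ => (x : ℂ) ^ (u - 1) * (1 - (x : ℂ)) ^ (v - 1)) (Ioo 0 1) := by
  have := Complex.betaIntegral_convergent hu hv
  rw [intervalIntegrable_iff_integrableOn_Ioo_of_le zero_le_one] at this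
  exact this

/-- Ptolemy's theorem for four concyclic points; it evaluates `1 - arcParam`. -/
lemma sin_half_ptolemy (t t₁ t₂ t₃ : ℝ) :
    Real.sin ((t₂ - t₁) / 2) * Real.sin ((t₃ - t) / 2) =
      Real.sin ((t - t₁) / 2) * Real.sin ((t₃ - t₂) / 2) +
      Real.sin ((t₂ - t) / 2) * Real.sin ((t₃ - t₁) / 2) := by
  have e1 : (t₂ - t₁) / 2 = t₂ / 2 - t₁ / 2 := by ring
  have e2 : (t₃ - t) / 2 = t₃ / 2 - t / 2 := by ring
  have e3 : (t - t₁) / 2 = t / 2 - t₁ / 2 := by ring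
  have e4 : (t₃ - t₂) / 2 = t₃ / 2 - t₂ / 2 := by ring
  have e5 : (t₂ - t) / 2 = t₂ / 2 - t / 2 := by ring
  have e6 : (t₃ - t₁) / 2 = t₃ / 2 - t₁ / 2 := by ring
  rw [e1, e2, e3, e4, e5, e6]
  simp only [Real.sin_sub]
  ring

/-- The Möbius-invariant parameter of the arc from `t₁` to `t₂` seen from `t₃`. -/
noncomputable def arcParam (t₁ t₂ t₃ t : ℝ) : ℝ :=
  Real.sin ((t - t₁) / 2) * Real.sin ((t₃ - t₂) / 2) /
    (Real.sin ((t₂ - t₁) / 2) * Real.sin ((t₃ - t) / 2))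

section Arc

variable {t₁ t₂ t₃ : ℝ}

lemma hasDerivAt_arcParam (h12 : t₁ < t₂) (h23 : t₂ < t₃) (h31 : t₃ < t₁ + 2 * Real.pi) {t : ℝ}
    (ht : t ∈ Icc t₁ t₂) :
    HasDerivAt (arcParam t₁ t₂ t₃)
      (1 / 2 * (Real.sin ((t₃ - t₂) / 2) * Real.sin ((t₃ - t₁) / 2)) /
        (Real.sin ((t₂ - t₁) / 2) * Real.sin ((t₃ - t) / 2) ^ 2)) t := by
  have p12 : 0 < Real.sin ((t₂ - t₁) / 2) := sin_half_pos (by linarith) (by linarith)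
  have p3 : 0 < Real.sin ((t₃ - t) / 2) := sin_half_pos (by linarith [ht.2]) (by linarith [ht.1])
  have d1 : HasDerivAt (fun t : ℝ => Real.sin ((t - t₁) / 2)) (Real.cos ((t - t₁) / 2) * (1 / 2)) t :=
    (((hasDerivAt_id t).sub_const t₁).div_const 2).sin
  have d3 : HasDerivAt (fun t : ℝ => Real.sin ((t₃ - t) / 2))
      (Real.cos ((t₃ - t) / 2) * (-1 / 2)) t :=
    (((hasDerivAt_id t).const_sub t₃).div_const 2).sin
  have := (d1.mul_const (Real.sin ((t₃ - t₂) / 2))).div (d3.const_mul (Real.sin ((t₂ - t₁) / 2)))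
    (by positivity)
  refine this.congr_deriv ?_
  -- The addition formula for `(t₃ - t) / 2 + (t - t₁) / 2` collapses the numerator of the quotient
  -- rule.
  have e : Real.sin ((t₃ - t₁) / 2) = Real.sin ((t₃ - t) / 2) * Real.cos ((t - t₁) / 2) +
      Real.cos ((t₃ - t) / 2) * Real.sin ((t - t₁) / 2) := by
    rw [← Real.sin_add]; congr 1; ring
  rw [e]
  field_simp
  ring

lemma image_arcParam (h12 : t₁ < t₂) (h23 : t₂ < t₃) (h31 : t₃ < t₁ + 2 * Real.pi) :
    InjOn (arcParam t₁ t₂ t₃) (Ioo t₁ t₂) ∧ arcParam t₁ t₂ t₃ '' Ioo t₁ t₂ = Ioo 0 1 := by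
  have p12 : 0 < Real.sin ((t₂ - t₁) / 2) := sin_half_pos (by linarith) (by linarith)
  have p23 : 0 < Real.sin ((t₃ - t₂) / 2) := sin_half_pos (by linarith) (by linarith)
  have p13 : 0 < Real.sin ((t₃ - t₁) / 2) := sin_half_pos (by linarith) (by linarith)
  have hc : ContinuousOn (arcParam t₁ t₂ t₃) (Icc t₁ t₂) := fun t ht =>
    (hasDerivAt_arcParam h12 h23 h31 ht).continuousAt.continuousWithinAt
  have hm : StrictMonoOn (arcParam t₁ t₂ t₃) (Icc t₁ t₂) := by
    refine strictMonoOn_of_deriv_pos (convex_Icc _ _) hc fun t ht => ?_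
    rw [interior_Icc] at ht
    have p3 : 0 < Real.sin ((t₃ - t) / 2) := sin_half_pos (by linarith [ht.2]) (by linarith [ht.1])
    rw [(hasDerivAt_arcParam h12 h23 h31 (Ioo_subset_Icc_self ht)).deriv]
    positivity
  have h0 : arcParam t₁ t₂ t₃ t₁ = 0 := by simp [arcParam]
  have h1 : arcParam t₁ t₂ t₃ t₂ = 1 := by
    rw [arcParam]; field_simp
  refine ⟨hm.injOn.mono Ioo_subset_Icc_self, Subset.antisymm ?_ ?_⟩
  · rintro _ ⟨t, ht, rfl⟩
    have ht' := Ioo_subset_Icc_self ht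
    rw [← h0, ← h1]
    exact ⟨hm (left_mem_Icc.2 h12.le) ht' ht.1, hm ht' (right_mem_Icc.2 h12.le) ht.2⟩
  · have := intermediate_value_Ioo h12.le hc
    rwa [h0, h1] at this

/-- This is the change of variables `arcParam` at the level of integrands. Total degree `-2` is what
makes the powers of the chord to `t₃` match the squared sine in the Jacobian; the leading `2`
cancels the `1 / 2` there. -/
lemma arc_integrand_eq (h23 : t₂ < t₃) (h31 : t₃ < t₁ + 2 * Real.pi)
    {a b c : ℂ} (habc : a + b + c = -2) {t : ℝ} (ht : t ∈ Ioo t₁ t₂) :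
    (chord (t - t₁) : ℂ) ^ a * (chord (t - t₂) : ℂ) ^ b * (chord (t - t₃) : ℂ) ^ c =
      2 * ((chord (t₁ - t₂) : ℂ) ^ (-1 - c) * (chord (t₁ - t₃) : ℂ) ^ (-1 - b) *
        (chord (t₂ - t₃) : ℂ) ^ (-1 - a)) *
      (|1 / 2 * (Real.sin ((t₃ - t₂) / 2) * Real.sin ((t₃ - t₁) / 2)) /
        (Real.sin ((t₂ - t₁) / 2) * Real.sin ((t₃ - t) / 2) ^ 2)| •
      ((arcParam t₁ t₂ t₃ t : ℂ) ^ (a + 1 - 1) * (1 - (arcParam t₁ t₂ t₃ t : ℂ)) ^ (b + 1 - 1))) := by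
  obtain ⟨ht1, ht2⟩ := ht
  rw [chord_sub_comm t t₂, chord_sub_comm t t₃, chord_sub_comm t₁ t₂, chord_sub_comm t₁ t₃,
    chord_sub_comm t₂ t₃]
  rw [chord_eq_sin (t := t - t₁), chord_eq_sin (t := t₂ - t), chord_eq_sin (t := t₃ - t),
    chord_eq_sin (t := t₂ - t₁), chord_eq_sin (t := t₃ - t₁), chord_eq_sin (t := t₃ - t₂)]
  rotate_left
  iterate 12 linarith
  have hpt := sin_half_ptolemy t t₁ t₂ t₃
  rw [arcParam]
  have p12 : 0 < Real.sin ((t₂ - t₁) / 2) := sin_half_pos (by linarith) (by linarith)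
  have p23 : 0 < Real.sin ((t₃ - t₂) / 2) := sin_half_pos (by linarith) (by linarith)
  have p13 : 0 < Real.sin ((t₃ - t₁) / 2) := sin_half_pos (by linarith) (by linarith)
  have p1 : 0 < Real.sin ((t - t₁) / 2) := sin_half_pos (by linarith) (by linarith)
  have p2 : 0 < Real.sin ((t₂ - t) / 2) := sin_half_pos (by linarith) (by linarith)
  have p3 : 0 < Real.sin ((t₃ - t) / 2) := sin_half_pos (by linarith) (by linarith)
  generalize Real.sin ((t₂ - t₁) / 2) = s12 at *
  generalize Real.sin ((t₃ - t₂) / 2) = s23 at *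
  generalize Real.sin ((t₃ - t₁) / 2) = s13 at *
  generalize Real.sin ((t - t₁) / 2) = s1 at *
  generalize Real.sin ((t₂ - t) / 2) = s2 at *
  generalize Real.sin ((t₃ - t) / 2) = s3 at *
  rw [abs_of_pos (by positivity)]
  have e1 : (1 - ((s1 * s23 / (s12 * s3) : ℝ) : ℂ)) = ((s2 * s13 / (s12 * s3) : ℝ) : ℂ) := by
    rw [← Complex.ofReal_one, ← Complex.ofReal_sub]
    congr 1
    field_simp
    linarith
  rw [e1, Complex.real_smul, add_sub_cancel_right, add_sub_cancel_right]
  -- All bases are positive, so the identity of complex powers becomes a linear identity between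
  -- exponents of real logarithms.
  have hlog : ∀ {x : ℝ} (_ : 0 < x) (z : ℂ), (x : ℂ) ^ z = Complex.exp (Real.log x * z) := by
    intro x hx z
    rw [Complex.cpow_def_of_ne_zero (by exact_mod_cast hx.ne'), Complex.ofReal_log hx.le]
  have hself : ∀ {x : ℝ} (_ : 0 < x), (x : ℂ) = Complex.exp (Real.log x) := by
    intro x hx
    rw [← Complex.ofReal_exp, Real.exp_log hx]
  have e2 : 1 / 2 * (s23 * s13) / (s12 * s3 ^ 2) = (1 / 2) * (s23 * s13 / (s12 * s3 ^ 2)) := by ring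
  rw [e2, Complex.ofReal_mul, hself (x := s23 * s13 / (s12 * s3 ^ 2)) (by positivity),
    hlog p1, hlog p2, hlog p3, hlog p12, hlog p13, hlog p23, hlog (x := s1 * s23 / (s12 * s3)) (by positivity),
    hlog (x := s2 * s13 / (s12 * s3)) (by positivity)]
  rw [Real.log_div, Real.log_div, Real.log_div, Real.log_mul, Real.log_mul, Real.log_mul,
    Real.log_mul, Real.log_mul, Real.log_pow]
  rotate_left
  iterate 16 positivity
  push_cast
  have hc : c = -2 - a - b := by linear_combination habc
  subst hc
  have hcomb : ∀ u v w x y z : ℂ, 2 * (u * v * w) * (1 / 2 * x * (y * z)) =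
      u * v * w * x * y * z := fun u v w x y z => by ring
  rw [hcomb]
  simp only [← Complex.exp_add]
  congr 1
  ring

lemma arc_integral (h12 : t₁ < t₂) (h23 : t₂ < t₃) (h31 : t₃ < t₁ + 2 * Real.pi)
    {a b c : ℂ} (habc : a + b + c = -2) (ha : -1 < a.re) (hb : -1 < b.re) :
    IntegrableOn (fun t : ℝ => (chord (t - t₁) : ℂ) ^ a * (chord (t - t₂) : ℂ) ^ b *
      (chord (t - t₃) : ℂ) ^ c) (Ioo t₁ t₂) ∧
    ∫ t in Ioo t₁ t₂, (chord (t - t₁) : ℂ) ^ a * (chord (t - t₂) : ℂ) ^ b *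
      (chord (t - t₃) : ℂ) ^ c =
      2 * ((chord (t₁ - t₂) : ℂ) ^ (-1 - c) * (chord (t₁ - t₃) : ℂ) ^ (-1 - b) *
        (chord (t₂ - t₃) : ℂ) ^ (-1 - a)) * Complex.betaIntegral (a + 1) (b + 1) := by
  obtain ⟨hinj, himg⟩ := image_arcParam h12 h23 h31
  have hd : ∀ t ∈ Ioo t₁ t₂, HasDerivWithinAt (arcParam t₁ t₂ t₃) _ (Ioo t₁ t₂) t := fun t ht =>
    (hasDerivAt_arcParam h12 h23 h31 (Ioo_subset_Icc_self ht)).hasDerivWithinAt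
  have hB := betaIntegral_integrableOn (u := a + 1) (v := b + 1)
    (by simp; linarith) (by simp; linarith)
  have hI := (integrableOn_image_iff_integrableOn_abs_deriv_smul measurableSet_Ioo hd hinj
    (fun x : ℝ => (x : ℂ) ^ (a + 1 - 1) * (1 - (x : ℂ)) ^ (b + 1 - 1))).1 (himg ▸ hB)
  have hE := integral_image_eq_integral_abs_deriv_smul measurableSet_Ioo hd hinj
    (fun x : ℝ => (x : ℂ) ^ (a + 1 - 1) * (1 - (x : ℂ)) ^ (b + 1 - 1))
  have hpt := fun t (ht : t ∈ Ioo t₁ t₂) => arc_integrand_eq h23 h31 habc ht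
  refine ⟨?_, ?_⟩
  · rw [integrableOn_congr_fun hpt measurableSet_Ioo]
    exact Integrable.const_mul hI _
  · rw [setIntegral_congr_fun measurableSet_Ioo hpt, integral_const_mul, ← hE, himg,
      Complex.betaIntegral, intervalIntegral.integral_of_le zero_le_one, integral_Ioc_eq_integral_Ioo]

end Arc

/-- The integral over the circle of a product of three chord powers with total exponent `-2`,
weighted by a constant on each of the three arcs. -/
lemma three_arc_integral {u v : ℝ} (hu : 0 < u) (huv : u < v) (hv : v < 2 * Real.pi)
    {a b c : ℂ} (habc : a + b + c = -2) (ha : -1 < a.re) (hb : -1 < b.re) (hc : -1 < c.re)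
    {m₁ m₂ m₃ : ℂ} {F : ℝ → ℂ}
    (h₁ : ∀ t ∈ Ioo 0 u, F t = m₁ *
      ((chord t : ℂ) ^ a * (chord (t - u) : ℂ) ^ b * (chord (t - v) : ℂ) ^ c))
    (h₂ : ∀ t ∈ Ioo u v, F t = m₂ *
      ((chord t : ℂ) ^ a * (chord (t - u) : ℂ) ^ b * (chord (t - v) : ℂ) ^ c))
    (h₃ : ∀ t ∈ Ioo v (2 * Real.pi), F t = m₃ *
      ((chord t : ℂ) ^ a * (chord (t - u) : ℂ) ^ b * (chord (t - v) : ℂ) ^ c)) :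
    IntervalIntegrable F volume 0 (2 * Real.pi) ∧
    ∫ t in (0 : ℝ)..(2 * Real.pi), F t =
      2 * ((chord u : ℂ) ^ (-1 - c) * (chord v : ℂ) ^ (-1 - b) * (chord (u - v) : ℂ) ^ (-1 - a)) *
        (m₁ * Complex.betaIntegral (a + 1) (b + 1) + m₂ * Complex.betaIntegral (b + 1) (c + 1) +
          m₃ * Complex.betaIntegral (c + 1) (a + 1)) := by
  have key : ∀ {s e : ℝ} {m B : ℂ} (_ : s ≤ e)
      (_ : ∀ t ∈ Ioo s e, F t = m *
        ((chord t : ℂ) ^ a * (chord (t - u) : ℂ) ^ b * (chord (t - v) : ℂ) ^ c))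
      (_ : IntegrableOn (fun t : ℝ => (chord t : ℂ) ^ a * (chord (t - u) : ℂ) ^ b *
          (chord (t - v) : ℂ) ^ c) (Ioo s e) ∧
        ∫ t in Ioo s e, (chord t : ℂ) ^ a * (chord (t - u) : ℂ) ^ b * (chord (t - v) : ℂ) ^ c = B),
      IntervalIntegrable F volume s e ∧ ∫ t in s..e, F t = m * B := by
    rintro s e m B hse hF ⟨hi, hB⟩
    constructor
    · rw [intervalIntegrable_iff_integrableOn_Ioo_of_le hse,
        integrableOn_congr_fun hF measurableSet_Ioo]
      exact Integrable.const_mul hi _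
    · rw [intervalIntegral.integral_of_le hse, integral_Ioc_eq_integral_Ioo,
        setIntegral_congr_fun measurableSet_Ioo hF, integral_const_mul, hB]
  have per : ∀ t, chord (t - 2 * Real.pi) = chord t := fun t => chord_periodic.sub_eq t
  have per' : ∀ t s, chord (t - (s + 2 * Real.pi)) = chord (t - s) := fun t s => by
    rw [← sub_sub, per]
  have A1 := arc_integral (t₁ := 0) hu huv (by linarith) habc ha hb
  -- The three points are taken in cyclic order; the third one, and on the last arc also the right
  -- endpoint, is shifted by `2π` to keep the ordering hypotheses true.
  have A2 := arc_integral (t₃ := 2 * Real.pi) huv hv (by linarith)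
    (a := b) (b := c) (c := a) (by rw [← habc]; ring) hb hc
  have A3 := arc_integral (t₃ := u + 2 * Real.pi) hv (by linarith) (by linarith)
    (a := c) (b := a) (c := b) (by rw [← habc]; ring) hc ha
  simp only [sub_zero, zero_sub, chord_neg, per, per'] at A1 A2 A3
  have e2 : ∀ t : ℝ, (chord (t - u) : ℂ) ^ b * (chord (t - v) : ℂ) ^ c * (chord t : ℂ) ^ a =
      (chord t : ℂ) ^ a * (chord (t - u) : ℂ) ^ b * (chord (t - v) : ℂ) ^ c := fun t => by ring
  have e3 : ∀ t : ℝ, (chord (t - v) : ℂ) ^ c * (chord t : ℂ) ^ a * (chord (t - u) : ℂ) ^ b =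
      (chord t : ℂ) ^ a * (chord (t - u) : ℂ) ^ b * (chord (t - v) : ℂ) ^ c := fun t => by ring
  have e4 : chord (2 * Real.pi - u) = chord u := by rw [chord_sub_comm, per]
  simp only [e2, e3, chord_sub_comm v u, e4] at A2 A3
  obtain ⟨i1, I1⟩ := key hu.le h₁ A1
  obtain ⟨i2, I2⟩ := key huv.le h₂ A2
  obtain ⟨i3, I3⟩ := key hv.le h₃ A3
  refine ⟨(i1.trans i2).trans i3, ?_⟩
  rw [← intervalIntegral.integral_add_adjacent_intervals (i1.trans i2) i3,
    ← intervalIntegral.integral_add_adjacent_intervals i1 i2, I1, I2, I3]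
  ring

/-- The denominator `Γ(a + b + 2)` is `Γ(1 - (c + 1))`, so reflection moves it upstairs. The Gamma
product is then symmetric in the exponents, and only the sine remembers the arc. -/
lemma betaIntegral_eq_Gamma_mul_sin {a b c : ℂ} (habc : a + b + c = -2)
    (ha : -1 < a.re) (hb : -1 < b.re) (hc : -1 < c.re) :
    Complex.betaIntegral (a + 1) (b + 1) =
      Complex.Gamma (a + 1) * Complex.Gamma (b + 1) * Complex.Gamma (c + 1) *
        (-Complex.sin (Real.pi * c)) / Real.pi := by
  have ha' : 0 < (a + 1).re := by simp; linarith
  have hb' : 0 < (b + 1).re := by simp; linarith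
  have hc' : 0 < (c + 1).re := by simp; linarith
  have e : a + 1 + (b + 1) = 1 - (c + 1) := by linear_combination habc
  have hab : 0 < (1 - (c + 1)).re := by rw [← e]; simpa using add_pos ha' hb'
  have hrefl := Complex.Gamma_mul_Gamma_one_sub (c + 1)
  have hs : Complex.sin (Real.pi * (c + 1)) = -Complex.sin (Real.pi * c) := by
    rw [mul_add, mul_one, Complex.sin_add_pi]
  have hG := Complex.Gamma_ne_zero_of_re_pos hab
  have hGc := Complex.Gamma_ne_zero_of_re_pos hc'
  have hpi : (Real.pi : ℂ) ≠ 0 := by exact_mod_cast Real.pi_ne_zero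
  rw [hs] at hrefl
  have hs0 : -Complex.sin (Real.pi * c) ≠ 0 := by
    intro h
    rw [h, div_zero] at hrefl
    exact mul_ne_zero hGc hG hrefl
  rw [Complex.Gamma_mul_Gamma_eq_betaIntegral ha' hb', e]
  rw [eq_div_iff hs0] at hrefl
  rw [eq_div_iff hpi]
  linear_combination (-Complex.betaIntegral (a + 1) (b + 1)) * hrefl

end ChiralPotts

/-! ### Algebra of rapidities: the three-term sine identity -/

namespace ChiralPotts
variable {k k' : ℂ}

namespace Rapidity

/-- `e^{iθ/2}`. -/
noncomputable def halfExp (p : Rapidity k k') : ℂ := Complex.exp (Complex.I * p.θ / 2)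

/-- `e^{iπλ}`. -/
noncomputable def lamExp (p : Rapidity k k') : ℂ := Complex.exp (Real.pi * Complex.I * p.lam)

lemma halfExp_ne_zero (p : Rapidity k k') : p.halfExp ≠ 0 := Complex.exp_ne_zero _

lemma lamExp_ne_zero (p : Rapidity k k') : p.lamExp ≠ 0 := Complex.exp_ne_zero _

lemma halfExp_sq (p : Rapidity k k') : p.halfExp ^ 2 = Complex.exp (Complex.I * p.θ) := by
  rw [halfExp, ← Complex.exp_nat_mul]
  congr 1
  push_cast
  ring

lemma exp_gamma_mul_lamExp (p : Rapidity k k') :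
    Complex.exp p.γ * p.lamExp = (p.halfExp ^ 2 + k) / k' := by
  rw [halfExp_sq, ← p.exp_gamma_add, Complex.exp_add, lamExp, lam]

lemma exp_gamma_div_lamExp (p : Rapidity k k') :
    Complex.exp p.γ / p.lamExp = ((p.halfExp ^ 2)⁻¹ + k) / k' := by
  rw [halfExp_sq, ← Complex.exp_neg, ← p.exp_gamma_sub, Complex.exp_sub, lamExp, lam]

lemma exp_phi_half (p : Rapidity k k') :
    Complex.exp (Complex.I * p.φ / 2) = p.lamExp / p.halfExp := by
  rw [lamExp, halfExp, ← Complex.exp_sub, lam]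
  congr 1
  have hpi : (Real.pi : ℂ) ≠ 0 := by exact_mod_cast Real.pi_ne_zero
  field_simp
  ring

end Rapidity

open Rapidity

lemma two_I_ne_zero : (2 * Complex.I : ℂ) ≠ 0 := mul_ne_zero two_ne_zero Complex.I_ne_zero

lemma sin_sub_eq_exp_div (u v : ℂ) : Complex.sin (u - v) =
    (Complex.exp (Complex.I * u) / Complex.exp (Complex.I * v) -
      Complex.exp (Complex.I * v) / Complex.exp (Complex.I * u)) / (2 * Complex.I) := by
  rw [Complex.sin, ← Complex.exp_sub, ← Complex.exp_sub]
  have h : ∀ z : ℂ, z * Complex.I / 2 = -(z / (2 * Complex.I)) := by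
    intro z
    field_simp
    simp
  rw [h, ← neg_div, neg_sub]
  congr 4 <;> ring

lemma sin_pi_mul_lam_sub (p q : Rapidity k k') :
    Complex.sin (Real.pi * (q.lam - p.lam)) =
      (q.lamExp / p.lamExp - p.lamExp / q.lamExp) / (2 * Complex.I) := by
  rw [mul_sub, sin_sub_eq_exp_div, lamExp, lamExp]
  congr 4 <;> ring

lemma sin_pi_mul_alphaBar (p q : Rapidity k k') :
    Complex.sin (Real.pi * alphaBar p q) =
      (q.lamExp / q.halfExp / (p.lamExp / p.halfExp) -
        p.lamExp / p.halfExp / (q.lamExp / q.halfExp)) / (2 * Complex.I) := by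
  have hpi : (Real.pi : ℂ) ≠ 0 := by exact_mod_cast Real.pi_ne_zero
  have e : Real.pi * alphaBar p q = q.φ / 2 - p.φ / 2 := by
    rw [alphaBar]; field_simp
  rw [e, sin_sub_eq_exp_div, ← exp_phi_half, ← exp_phi_half]
  congr 4 <;> ring

lemma sin_pi_ne_zero {z : ℂ} (h0 : 0 < z.re) (h1 : z.re < 1) : Complex.sin (Real.pi * z) ≠ 0 := by
  rw [Complex.sin_ne_zero_iff]
  intro n h
  have hpi : (Real.pi : ℂ) ≠ 0 := by exact_mod_cast Real.pi_ne_zero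
  have hz : z = n := mul_left_cancel₀ hpi (by rw [h]; ring)
  rw [hz, Complex.intCast_re] at h0 h1
  have h0' : 0 < n := by exact_mod_cast h0
  have h1' : n < 1 := by exact_mod_cast h1
  omega

/-- Multiplying the sine by `e^{γ_p + γ_q}` groups its exponentials into the products `e^{γ}
e^{±iπλ}`, which are rational in `e^{iθ}`. -/
lemma two_I_mul_sin_lam (hk' : k' ≠ 0) (p q : Rapidity k k') :
    Complex.sin (Real.pi * (q.lam - p.lam)) * (2 * Complex.I) * Complex.exp p.γ * Complex.exp q.γ
      * (p.halfExp ^ 2 * q.halfExp ^ 2 * k' ^ 2) =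
      (q.halfExp ^ 2 - p.halfExp ^ 2) *
        (q.halfExp ^ 2 + p.halfExp ^ 2 + k * (1 + p.halfExp ^ 2 * q.halfExp ^ 2)) := by
  have hp := p.exp_gamma_mul_lamExp
  have hq := q.exp_gamma_mul_lamExp
  have hp' := p.exp_gamma_div_lamExp
  have hq' := q.exp_gamma_div_lamExp
  have e : Complex.sin (Real.pi * (q.lam - p.lam)) * (2 * Complex.I) * Complex.exp p.γ *
      Complex.exp q.γ = (Complex.exp q.γ * q.lamExp) * (Complex.exp p.γ / p.lamExp) -
      (Complex.exp p.γ * p.lamExp) * (Complex.exp q.γ / q.lamExp) := by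
    rw [sin_pi_mul_lam_sub, div_mul_cancel₀ _ two_I_ne_zero]
    ring
  rw [e, hp, hq, hp', hq']
  have := p.halfExp_ne_zero
  have := q.halfExp_ne_zero
  field_simp
  ring

/-- The same grouping applies, with extra factors `e^{±i(θ_p - θ_q)/2}`. The numerator is then
divisible by `1 - k ^ 2 = k' ^ 2`, so `k` disappears. -/
lemma two_I_mul_sin_alphaBar (hk : k ^ 2 + k' ^ 2 = 1) (hk' : k' ≠ 0) (p q : Rapidity k k') :
    Complex.sin (Real.pi * alphaBar p q) * (2 * Complex.I) * Complex.exp p.γ * Complex.exp q.γ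
      * (p.halfExp * q.halfExp) = q.halfExp ^ 2 - p.halfExp ^ 2 := by
  have hp := p.exp_gamma_mul_lamExp
  have hq := q.exp_gamma_mul_lamExp
  have hp' := p.exp_gamma_div_lamExp
  have hq' := q.exp_gamma_div_lamExp
  have e : Complex.sin (Real.pi * alphaBar p q) * (2 * Complex.I) * Complex.exp p.γ *
      Complex.exp q.γ = (Complex.exp q.γ * q.lamExp) * (Complex.exp p.γ / p.lamExp)
        * (p.halfExp / q.halfExp) -
      (Complex.exp p.γ * p.lamExp) * (Complex.exp q.γ / q.lamExp) * (q.halfExp / p.halfExp) := by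
    rw [sin_pi_mul_alphaBar, div_mul_cancel₀ _ two_I_ne_zero]
    field_simp
  rw [e, hp, hq, hp', hq']
  have := p.halfExp_ne_zero
  have := q.halfExp_ne_zero
  field_simp
  linear_combination (-(q.halfExp ^ 2 - p.halfExp ^ 2)) * hk

lemma exp_gamma_sq (hk' : k' ≠ 0) (p : Rapidity k k') :
    Complex.exp p.γ ^ 2 * (k' ^ 2 * p.halfExp ^ 2) =
      (p.halfExp ^ 2 + k) * (1 + k * p.halfExp ^ 2) := by
  have e : Complex.exp p.γ ^ 2 = (Complex.exp p.γ * p.lamExp) * (Complex.exp p.γ / p.lamExp) := by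
    have := p.lamExp_ne_zero
    field_simp
  have := p.halfExp_ne_zero
  rw [e, exp_gamma_mul_lamExp, exp_gamma_div_lamExp]
  field_simp

lemma halfExp_sq_sub_ne_zero (hk' : k' ≠ 0) {p q : Rapidity k k'}
    (h0 : 0 < (q.lam - p.lam).re) (h1 : (q.lam - p.lam).re < 1) :
    q.halfExp ^ 2 - p.halfExp ^ 2 ≠ 0 := by
  intro h
  have := two_I_mul_sin_lam hk' p q
  rw [h, zero_mul] at this
  have h1 := sin_pi_ne_zero h0 h1
  have := p.halfExp_ne_zero
  have := q.halfExp_ne_zero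
  simp_all [Complex.exp_ne_zero]

/-- Nothing bounds the real part of `alphaBar` itself; nonvanishing is transferred from `sin π(λ_q -
λ_p)`, since both sines carry the factor `e^{iθ_q} - e^{iθ_p}`. -/
lemma sin_alphaBar_ne_zero (hk : k ^ 2 + k' ^ 2 = 1) (hk' : k' ≠ 0) {p q : Rapidity k k'}
    (h0 : 0 < (q.lam - p.lam).re) (h1 : (q.lam - p.lam).re < 1) :
    Complex.sin (Real.pi * alphaBar p q) ≠ 0 := by
  intro h
  have := two_I_mul_sin_alphaBar hk hk' p q
  rw [h] at this
  simp only [zero_mul] at this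
  exact halfExp_sq_sub_ne_zero hk' h0 h1 this.symm

/-- The three-term sum of arc weights when the arcs are met in the order `z, y, x`. -/
noncomputable def arcSum (p q r : Rapidity k k') : ℂ :=
  Complex.sin (Real.pi * (r.lam - p.lam)) +
    Complex.exp (q.γ + r.γ) * Complex.sin (Real.pi * (q.lam - p.lam)) +
    Complex.exp (p.γ + q.γ) * Complex.sin (Real.pi * (r.lam - q.lam))

/-- This factorisation is the heart of the star-triangle relation. The factors on the right are
those of `sin π ᾱ_pr`, `sin π(λ_q - λ_p)` and `sin π(λ_r - λ_q)`, without the differences belonging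
to `pq` and `qr`. -/
lemma arcSum_cleared (hk : k ^ 2 + k' ^ 2 = 1) (hk' : k' ≠ 0) (p q r : Rapidity k k') :
    arcSum p q r * (2 * Complex.I) * Complex.exp p.γ * Complex.exp r.γ *
      (k' ^ 4 * p.halfExp ^ 2 * q.halfExp ^ 2 * r.halfExp ^ 2) =
    (r.halfExp ^ 2 - p.halfExp ^ 2) *
      (q.halfExp ^ 2 + p.halfExp ^ 2 + k * (1 + p.halfExp ^ 2 * q.halfExp ^ 2)) *
      (r.halfExp ^ 2 + q.halfExp ^ 2 + k * (1 + q.halfExp ^ 2 * r.halfExp ^ 2)) := by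
  have hpq := two_I_mul_sin_lam hk' p q
  have hqr := two_I_mul_sin_lam hk' q r
  have hpr := two_I_mul_sin_lam hk' p r
  have wp := exp_gamma_sq hk' p
  have wr := exp_gamma_sq hk' r
  have hk2 : k' ^ 2 = 1 - k ^ 2 := by linear_combination hk
  rw [arcSum, Complex.exp_add, Complex.exp_add]
  generalize Complex.sin (Real.pi * (r.lam - p.lam)) = Spr at *
  generalize Complex.sin (Real.pi * (q.lam - p.lam)) = Spq at *
  generalize Complex.sin (Real.pi * (r.lam - q.lam)) = Sqr at *
  generalize Complex.exp p.γ = gp at *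
  generalize Complex.exp q.γ = gq at *
  generalize Complex.exp r.γ = gr at *
  generalize p.halfExp ^ 2 = X at *
  generalize q.halfExp ^ 2 = Y at *
  generalize r.halfExp ^ 2 = Z at *
  -- The terms are regrouped so that each sine appears in its cleared form and the leftover `gr ^
  -- 2`, `gp ^ 2` are rational by `exp_gamma_sq`.
  have e : (Spr + gq * gr * Spq + gp * gq * Sqr) * (2 * Complex.I) * gp * gr *
      (k' ^ 4 * X * Y * Z) =
      (Spr * (2 * Complex.I) * gp * gr * (X * Z * k' ^ 2)) * (k' ^ 2 * Y) +
      (Spq * (2 * Complex.I) * gp * gq * (X * Y * k' ^ 2)) * (gr ^ 2 * (k' ^ 2 * Z)) +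
      (Sqr * (2 * Complex.I) * gq * gr * (Y * Z * k' ^ 2)) * (gp ^ 2 * (k' ^ 2 * X)) := by ring
  rw [e, hpq, hqr, hpr, wp, wr, hk2]
  ring

lemma arcSum_mul_sin_alphaBar (hk : k ^ 2 + k' ^ 2 = 1) (hk' : k' ≠ 0) (p q r : Rapidity k k') :
    arcSum p q r * (Complex.sin (Real.pi * alphaBar p q) * Complex.sin (Real.pi * alphaBar q r)) =
    Complex.sin (Real.pi * (q.lam - p.lam)) * Complex.sin (Real.pi * (r.lam - q.lam)) *
      Complex.sin (Real.pi * alphaBar p r) := by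
  have hpq := two_I_mul_sin_lam hk' p q
  have hqr := two_I_mul_sin_lam hk' q r
  have apq := two_I_mul_sin_alphaBar hk hk' p q
  have aqr := two_I_mul_sin_alphaBar hk hk' q r
  have apr := two_I_mul_sin_alphaBar hk hk' p r
  have hN := arcSum_cleared hk hk' p q r
  have hx := p.halfExp_ne_zero
  have hy := q.halfExp_ne_zero
  have hz := r.halfExp_ne_zero
  have hp := Complex.exp_ne_zero p.γ
  have hq := Complex.exp_ne_zero q.γ
  have hr := Complex.exp_ne_zero r.γ
  have hI := two_I_ne_zero
  refine mul_right_cancel₀ (b := (2 * Complex.I) ^ 3 * Complex.exp p.γ ^ 2 * Complex.exp q.γ ^ 2 *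
    Complex.exp r.γ ^ 2 * (p.halfExp * q.halfExp * r.halfExp) ^ 3 * q.halfExp * k' ^ 4)
    (by positivity) ?_
  generalize Complex.sin (Real.pi * (q.lam - p.lam)) = Spq at *
  generalize Complex.sin (Real.pi * (r.lam - q.lam)) = Sqr at *
  generalize Complex.sin (Real.pi * alphaBar p q) = Apq at *
  generalize Complex.sin (Real.pi * alphaBar q r) = Aqr at *
  generalize Complex.sin (Real.pi * alphaBar p r) = Apr at *
  generalize Complex.exp p.γ = gp at *
  generalize Complex.exp q.γ = gq at *
  generalize Complex.exp r.γ = gr at *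
  generalize p.halfExp = x at *
  generalize q.halfExp = y at *
  generalize r.halfExp = z at *
  trans (arcSum p q r * (2 * Complex.I) * gp * gr * (k' ^ 4 * x ^ 2 * y ^ 2 * z ^ 2)) *
    (Apq * (2 * Complex.I) * gp * gq * (x * y)) * (Aqr * (2 * Complex.I) * gq * gr * (y * z))
  · ring
  trans (Spq * (2 * Complex.I) * gp * gq * (x ^ 2 * y ^ 2 * k' ^ 2)) *
    (Sqr * (2 * Complex.I) * gq * gr * (y ^ 2 * z ^ 2 * k' ^ 2)) *
    (Apr * (2 * Complex.I) * gp * gr * (x * z))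
  · rw [hN, apq, aqr, hpq, hqr, apr]
    ring
  · ring

/-- The left side is the sum of arc weights for the order `z, x, y`. The factor `e^{γ_p - γ_q}` is
the jump of `W p q (x - y)` as `x - y` becomes negative, so both orders lead to the same constant.
-/
lemma arcSum_swap (hk : k ^ 2 + k' ^ 2 = 1) (hk' : k' ≠ 0) (p q r : Rapidity k k') :
    Complex.sin (Real.pi * (r.lam - q.lam)) +
      Complex.exp (p.γ - r.γ) * Complex.sin (Real.pi * (q.lam - p.lam)) +
      Complex.exp (p.γ + q.γ) * Complex.sin (Real.pi * (r.lam - p.lam)) =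
    Complex.exp (p.γ - q.γ) * arcSum p q r := by
  have hpq := two_I_mul_sin_lam hk' p q
  have hqr := two_I_mul_sin_lam hk' q r
  have hpr := two_I_mul_sin_lam hk' p r
  have hN := arcSum_cleared hk hk' p q r
  have eq2 := exp_gamma_sq hk' q
  have hx := p.halfExp_ne_zero
  have hy := q.halfExp_ne_zero
  have hz := r.halfExp_ne_zero
  have hp := Complex.exp_ne_zero p.γ
  have hq := Complex.exp_ne_zero q.γ
  have hr := Complex.exp_ne_zero r.γ
  have hI := two_I_ne_zero
  have hk2 : k' ^ 2 = 1 - k ^ 2 := by linear_combination hk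
  refine mul_right_cancel₀ (b := (2 * Complex.I) * Complex.exp q.γ * Complex.exp r.γ *
    (k' ^ 4 * p.halfExp ^ 2 * q.halfExp ^ 2 * r.halfExp ^ 2)) (by positivity) ?_
  rw [Complex.exp_sub, Complex.exp_sub, Complex.exp_add]
  generalize Complex.sin (Real.pi * (r.lam - p.lam)) = Spr at *
  generalize Complex.sin (Real.pi * (q.lam - p.lam)) = Spq at *
  generalize Complex.sin (Real.pi * (r.lam - q.lam)) = Sqr at *
  generalize Complex.exp p.γ = gp at *
  generalize Complex.exp q.γ = gq at *
  generalize Complex.exp r.γ = gr at *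
  generalize arcSum p q r = N at *
  generalize p.halfExp ^ 2 = X at *
  generalize q.halfExp ^ 2 = Y at *
  generalize r.halfExp ^ 2 = Z at *
  trans N * (2 * Complex.I) * gp * gr * (k' ^ 4 * X * Y * Z)
  · trans (Sqr * (2 * Complex.I) * gq * gr * (Y * Z * k' ^ 2)) * (k' ^ 2 * X) +
      (Spq * (2 * Complex.I) * gp * gq * (X * Y * k' ^ 2)) * (k' ^ 2 * Z) +
      (Spr * (2 * Complex.I) * gp * gr * (X * Z * k' ^ 2)) * (gq ^ 2 * (k' ^ 2 * Y))
    · field_simp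
    · rw [hN, hpq, hqr, hpr, eq2, hk2]
      ring
  · field_simp

lemma fTilde_eq (p q : Rapidity k k') :
    fTilde p q = 1 / (Complex.sin (Real.pi * alphaBar p q) *
      Complex.Gamma (1 + p.lam - q.lam)) := by
  have hpi : (Real.pi : ℂ) ≠ 0 := by exact_mod_cast Real.pi_ne_zero
  have e : betaBar p q - alphaBar p q = 1 + p.lam - q.lam := by
    rw [betaBar, alphaBar, lam, lam]; ring
  rw [fTilde, Complex.Gamma_mul_Gamma_one_sub, e]
  field_simp

lemma Gamma_lam_ne_zero {p q : Rapidity k k'} (h1 : (q.lam - p.lam).re < 1) :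
    Complex.Gamma (1 + p.lam - q.lam) ≠ 0 := by
  apply Complex.Gamma_ne_zero_of_re_pos
  simp only [Complex.sub_re, Complex.add_re, Complex.one_re] at *
  linarith

lemma fTilde_ne_zero (hk : k ^ 2 + k' ^ 2 = 1) (hk' : k' ≠ 0) {p q : Rapidity k k'}
    (h0 : 0 < (q.lam - p.lam).re) (h1 : (q.lam - p.lam).re < 1) : fTilde p q ≠ 0 := by
  rw [fTilde_eq]
  exact one_div_ne_zero (mul_ne_zero (sin_alphaBar_ne_zero hk hk' h0 h1) (Gamma_lam_ne_zero h1))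

section Principal

variable {p q r : Rapidity k k'}

lemma Rinf_ne_zero (hk : k ^ 2 + k' ^ 2 = 1) (hk' : k' ≠ 0)
    (hpq : 0 < (q.lam - p.lam).re) (hqr : 0 < (r.lam - q.lam).re)
    (hpr : (r.lam - p.lam).re < 1) : Rinf p q r ≠ 0 := by
  simp only [Complex.sub_re] at hpq hqr hpr
  refine div_ne_zero (mul_ne_zero ?_ ?_) ?_ <;> apply fTilde_ne_zero hk hk' <;>
    simp only [Complex.sub_re] <;> linarith

/-- Reflection turns `Γ(λ_q - λ_p)` and `Γ(λ_r - λ_q)` into reciprocals that cancel the sines from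
`arcSum_mul_sin_alphaBar`; the remaining `1 + λ - λ` Gammas and `ᾱ` sines are those of `fTilde_eq`.
-/
lemma Gamma_mul_arcSum (hk : k ^ 2 + k' ^ 2 = 1) (hk' : k' ≠ 0)
    (hpq : 0 < (q.lam - p.lam).re) (hqr : 0 < (r.lam - q.lam).re)
    (hpr : (r.lam - p.lam).re < 1) :
    Complex.Gamma (q.lam - p.lam) * Complex.Gamma (r.lam - q.lam) *
      Complex.Gamma (1 + p.lam - r.lam) * arcSum p q r = Real.pi ^ 2 * Rinf p q r := by
  have hpq1 : (q.lam - p.lam).re < 1 := by simp only [Complex.sub_re] at *; linarith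
  have hqr1 : (r.lam - q.lam).re < 1 := by simp only [Complex.sub_re] at *; linarith
  have hpr0 : 0 < (r.lam - p.lam).re := by simp only [Complex.sub_re] at *; linarith
  have h := arcSum_mul_sin_alphaBar hk hk' p q r
  have a1 := sin_alphaBar_ne_zero hk hk' hpq hpq1
  have a2 := sin_alphaBar_ne_zero hk hk' hqr hqr1
  have a3 := sin_alphaBar_ne_zero hk hk' hpr0 hpr
  have s1 := sin_pi_ne_zero hpq hpq1
  have s2 := sin_pi_ne_zero hqr hqr1
  have g1 := Gamma_lam_ne_zero hpq1
  have g2 := Gamma_lam_ne_zero hqr1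
  have g3 := Gamma_lam_ne_zero hpr
  have r1 := Complex.Gamma_mul_Gamma_one_sub (q.lam - p.lam)
  have r2 := Complex.Gamma_mul_Gamma_one_sub (r.lam - q.lam)
  rw [show 1 - (q.lam - p.lam) = 1 + p.lam - q.lam by ring, ← eq_div_iff g1] at r1
  rw [show 1 - (r.lam - q.lam) = 1 + q.lam - r.lam by ring, ← eq_div_iff g2] at r2
  have h' : arcSum p q r = _ := eq_div_of_mul_eq (mul_ne_zero a1 a2) h
  rw [r1, r2, h', Rinf, fTilde_eq, fTilde_eq, fTilde_eq]
  field_simp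

end Principal
end ChiralPotts

/-! ### The star-triangle equation -/

namespace ChiralPotts
variable {k k' : ℂ}
open Set

lemma fract_periodic : Function.Periodic (fun x : ℝ => Int.fract (x / (2 * Real.pi)))
    (2 * Real.pi) := by
  intro x
  simp only
  rw [add_div, div_self Real.two_pi_pos.ne', Int.fract_add_one]

lemma fract_of_pos {t : ℝ} (h0 : 0 < t) (h1 : t < 2 * Real.pi) :
    Int.fract (t / (2 * Real.pi)) = t / (2 * Real.pi) :=
  Int.fract_eq_self.2 ⟨by positivity, (div_lt_one Real.two_pi_pos).2 h1⟩

lemma fract_of_neg {t : ℝ} (h0 : t < 0) (h1 : -(2 * Real.pi) < t) :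
    Int.fract (t / (2 * Real.pi)) = t / (2 * Real.pi) + 1 := by
  have h := fract_of_pos (t := t + 2 * Real.pi) (by linarith) (by linarith)
  rw [add_div, div_self Real.two_pi_pos.ne', Int.fract_add_one] at h
  exact h

lemma W_eq (p q : Rapidity k k') (x : ℝ) : W p q x =
    Complex.exp ((p.γ - q.γ) * (Int.fract (x / (2 * Real.pi)) : ℝ)) *
      (chord x : ℂ) ^ (p.lam - q.lam) := rfl

lemma Wbar_eq (p q : Rapidity k k') (x : ℝ) : Wbar p q x =
    Complex.exp ((p.γ + q.γ) * (Int.fract (x / (2 * Real.pi)) : ℝ)) *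
      (chord x : ℂ) ^ (q.lam - p.lam - 1) := rfl

lemma W_periodic (p q : Rapidity k k') : Function.Periodic (W p q) (2 * Real.pi) := by
  intro x
  have := fract_periodic x
  simp only at this
  rw [W_eq, W_eq, this, chord_periodic x]

lemma Wbar_periodic (p q : Rapidity k k') : Function.Periodic (Wbar p q) (2 * Real.pi) := by
  intro x
  have := fract_periodic x
  simp only at this
  rw [Wbar_eq, Wbar_eq, this, chord_periodic x]

/-- The star-triangle integrand with `z = 0`. -/
noncomputable def starIntegrand (p q r : Rapidity k k') (x y w : ℝ) : ℂ :=
  Wbar q r (y - w) * W p r (x - w) * Wbar p q w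

lemma exp_phase_combine {A B C a b c X Y Z : ℂ} : Complex.exp A * X ^ a * (Complex.exp B * Y ^ b) *
    (Complex.exp C * Z ^ c) = Complex.exp (A + B + C) * (Z ^ c * X ^ a * Y ^ b) := by
  rw [Complex.exp_add, Complex.exp_add]; ring

lemma sin_pi_one_sub (z : ℂ) : Complex.sin (Real.pi * (1 - z)) = Complex.sin (Real.pi * z) := by
  rw [mul_sub, mul_one, Complex.sin_pi_sub]

lemma beta_sin {p q : Rapidity k k'} : -Complex.sin (Real.pi * (q.lam - p.lam - 1)) =
    Complex.sin (Real.pi * (q.lam - p.lam)) := by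
  rw [← Complex.sin_neg, ← sin_pi_one_sub (q.lam - p.lam)]
  congr 1; ring

lemma beta_sin' {p q : Rapidity k k'} : -Complex.sin (Real.pi * (p.lam - q.lam)) =
    Complex.sin (Real.pi * (q.lam - p.lam)) := by
  rw [← Complex.sin_neg]
  congr 1; ring

section StarTriangle

variable {p q r : Rapidity k k'}

/-- Here `z = 0` and `x`, `y` lie in one period, so every fractional part is linear on each arc. The
two orders of `x` and `y` are treated separately because they give different phases. -/
lemma star_triangle_base (hk : k ^ 2 + k' ^ 2 = 1) (hk' : k' ≠ 0)
    (hpq : 0 < (q.lam - p.lam).re) (hqr : 0 < (r.lam - q.lam).re)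
    (hpr : (r.lam - p.lam).re < 1) {x y : ℝ} (hx0 : 0 < x) (hx1 : x < 2 * Real.pi)
    (hy0 : 0 < y) (hy1 : y < 2 * Real.pi) (hxy : x ≠ y) :
    IntervalIntegrable (starIntegrand p q r x y) volume 0 (2 * Real.pi) ∧
    (1 / (2 * Real.pi) : ℂ) * ∫ w in (0 : ℝ)..(2 * Real.pi), starIntegrand p q r x y w =
      Rinf p q r * (W p q (x - y) * Wbar p r y * W q r x) := by
  have hpi : (Real.pi : ℂ) ≠ 0 := by exact_mod_cast Real.pi_ne_zero
  have hG := Gamma_mul_arcSum hk hk' hpq hqr hpr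
  have hsw := arcSum_swap hk hk' p q r
  have ha : -1 < (q.lam - p.lam - 1).re := by simp only [Complex.sub_re, Complex.one_re] at *; linarith
  have hb : -1 < (r.lam - q.lam - 1).re := by simp only [Complex.sub_re, Complex.one_re] at *; linarith
  have hc : -1 < (p.lam - r.lam).re := by simp only [Complex.sub_re, Complex.one_re] at *; linarith
  -- The phase on the first arc: the `w`-terms `-(γ_q + γ_r) - (γ_p - γ_r) + (γ_p + γ_q)` cancel.
  set m : ℂ := Complex.exp ((q.γ + r.γ) * (y / (2 * Real.pi)) + (p.γ - r.γ) * (x / (2 * Real.pi)))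
  rcases lt_or_gt_of_ne hxy with h | h
  · have key := three_arc_integral hx0 h hy1 (a := q.lam - p.lam - 1) (b := p.lam - r.lam)
      (c := r.lam - q.lam - 1) (by ring) ha hc hb (F := starIntegrand p q r x y)
      -- Passing `w = x` adds `1` to the fractional part in `W p r`, and passing `w = y` does so in
      -- `Wbar q r`; the two jumps together give `γ_p + γ_q`.
      (m₁ := m) (m₂ := m * Complex.exp (p.γ - r.γ)) (m₃ := m * Complex.exp (p.γ + q.γ))
      ?_ ?_ ?_
    · refine ⟨key.1, ?_⟩
      rw [key.2, betaIntegral_eq_Gamma_mul_sin (c := r.lam - q.lam - 1) (by ring) ha hc hb,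
        betaIntegral_eq_Gamma_mul_sin (c := q.lam - p.lam - 1) (by ring) hc hb ha,
        betaIntegral_eq_Gamma_mul_sin (c := p.lam - r.lam) (by ring) hb ha hc,
        beta_sin, beta_sin, beta_sin']
      simp only [sub_add_cancel]
      rw [show p.lam - r.lam + 1 = 1 + p.lam - r.lam by ring, W_eq, W_eq, Wbar_eq,
        fract_of_neg (by linarith) (by linarith), fract_of_pos hx0 hx1, fract_of_pos hy0 hy1]
      have hm : Complex.exp ((p.γ - q.γ) * ((x - y) / (2 * Real.pi) + 1 : ℝ)) *
          (Complex.exp ((p.γ + r.γ) * (y / (2 * Real.pi) : ℝ)) *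
            Complex.exp ((q.γ - r.γ) * (x / (2 * Real.pi) : ℝ))) =
          m * Complex.exp (p.γ - q.γ) := by
        simp only [m, ← Complex.exp_add]
        congr 1
        push_cast
        ring
      rw [show -1 - (r.lam - q.lam - 1) = q.lam - r.lam by ring,
        show -1 - (p.lam - r.lam) = r.lam - p.lam - 1 by ring,
        show -1 - (q.lam - p.lam - 1) = p.lam - q.lam by ring]
      generalize (chord x : ℂ) ^ (q.lam - r.lam) = P1
      generalize (chord y : ℂ) ^ (r.lam - p.lam - 1) = P2
      generalize (chord (x - y) : ℂ) ^ (p.lam - q.lam) = P3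
      generalize Complex.Gamma (q.lam - p.lam) = G1 at *
      generalize Complex.Gamma (r.lam - q.lam) = G2 at *
      generalize Complex.Gamma (1 + p.lam - r.lam) = G3 at *
      clear_value m
      generalize Complex.exp ((p.γ - q.γ) * ((x - y) / (2 * Real.pi) + 1 : ℝ)) = E1 at *
      generalize Complex.exp ((p.γ + r.γ) * (y / (2 * Real.pi) : ℝ)) = E2 at *
      generalize Complex.exp ((q.γ - r.γ) * (x / (2 * Real.pi) : ℝ)) = E3 at *
      field_simp
      linear_combination (P1 * P2 * P3 * m * G1 * G2 * G3) * hsw +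
        (P1 * P2 * P3 * m * Complex.exp (p.γ - q.γ)) * hG -
        (P1 * P2 * P3 * Real.pi ^ 2 * Rinf p q r) * hm
    · rintro w ⟨hw0, hw1⟩
      rw [starIntegrand, W_eq, Wbar_eq, Wbar_eq, exp_phase_combine, chord_sub_comm y,
        chord_sub_comm x, fract_of_pos (by linarith) (by linarith),
        fract_of_pos (by linarith) (by linarith), fract_of_pos (by linarith) (by linarith)]
      simp only [m]
      push_cast
      rw [mul_right_comm ((chord w : ℂ) ^ _)]
      congr 2
      ring
    · rintro w ⟨hw0, hw1⟩
      rw [starIntegrand, W_eq, Wbar_eq, Wbar_eq, exp_phase_combine, chord_sub_comm y,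
        chord_sub_comm x, fract_of_pos (t := y - w) (by linarith) (by linarith),
        fract_of_neg (t := x - w) (by linarith) (by linarith),
        fract_of_pos (t := w) (by linarith) (by linarith)]
      simp only [m, ← Complex.exp_add]
      push_cast
      rw [mul_right_comm ((chord w : ℂ) ^ _)]
      congr 2
      ring
    · rintro w ⟨hw0, hw1⟩
      rw [starIntegrand, W_eq, Wbar_eq, Wbar_eq, exp_phase_combine, chord_sub_comm y,
        chord_sub_comm x, fract_of_neg (t := y - w) (by linarith) (by linarith),
        fract_of_neg (t := x - w) (by linarith) (by linarith),
        fract_of_pos (t := w) (by linarith) (by linarith)]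
      simp only [m, ← Complex.exp_add]
      push_cast
      rw [mul_right_comm ((chord w : ℂ) ^ _)]
      congr 2
      ring
  · have key := three_arc_integral hy0 h hx1 (a := q.lam - p.lam - 1) (b := r.lam - q.lam - 1)
      (c := p.lam - r.lam) (by ring) ha hb hc (F := starIntegrand p q r x y)
      (m₁ := m) (m₂ := m * Complex.exp (q.γ + r.γ)) (m₃ := m * Complex.exp (p.γ + q.γ))
      ?_ ?_ ?_
    · refine ⟨key.1, ?_⟩
      rw [key.2, betaIntegral_eq_Gamma_mul_sin (c := p.lam - r.lam) (by ring) ha hb hc,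
        betaIntegral_eq_Gamma_mul_sin (c := q.lam - p.lam - 1) (by ring) hb hc ha,
        betaIntegral_eq_Gamma_mul_sin (c := r.lam - q.lam - 1) (by ring) hc ha hb,
        beta_sin, beta_sin, beta_sin']
      simp only [sub_add_cancel]
      rw [show p.lam - r.lam + 1 = 1 + p.lam - r.lam by ring, W_eq, W_eq, Wbar_eq,
        fract_of_pos (t := x - y) (by linarith) (by linarith), fract_of_pos hx0 hx1,
        fract_of_pos hy0 hy1]
      have hm : Complex.exp ((p.γ - q.γ) * ((x - y) / (2 * Real.pi) : ℝ)) *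
          (Complex.exp ((p.γ + r.γ) * (y / (2 * Real.pi) : ℝ)) *
            Complex.exp ((q.γ - r.γ) * (x / (2 * Real.pi) : ℝ))) = m := by
        simp only [m, ← Complex.exp_add]
        congr 1
        push_cast
        ring
      rw [show -1 - (r.lam - q.lam - 1) = q.lam - r.lam by ring,
        show -1 - (p.lam - r.lam) = r.lam - p.lam - 1 by ring,
        show -1 - (q.lam - p.lam - 1) = p.lam - q.lam by ring, chord_sub_comm y x]
      rw [arcSum] at hG
      generalize (chord x : ℂ) ^ (q.lam - r.lam) = P1
      generalize (chord y : ℂ) ^ (r.lam - p.lam - 1) = P2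
      generalize (chord (x - y) : ℂ) ^ (p.lam - q.lam) = P3
      generalize Complex.Gamma (q.lam - p.lam) = G1 at *
      generalize Complex.Gamma (r.lam - q.lam) = G2 at *
      generalize Complex.Gamma (1 + p.lam - r.lam) = G3 at *
      clear_value m
      generalize Complex.exp ((p.γ - q.γ) * ((x - y) / (2 * Real.pi) : ℝ)) = E1 at *
      generalize Complex.exp ((p.γ + r.γ) * (y / (2 * Real.pi) : ℝ)) = E2 at *
      generalize Complex.exp ((q.γ - r.γ) * (x / (2 * Real.pi) : ℝ)) = E3 at *
      field_simp
      linear_combination (P1 * P2 * P3 * m) * hG - (P1 * P2 * P3 * Real.pi ^ 2 * Rinf p q r) * hm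
    · rintro w ⟨hw0, hw1⟩
      rw [starIntegrand, W_eq, Wbar_eq, Wbar_eq, exp_phase_combine, chord_sub_comm y,
        chord_sub_comm x, fract_of_pos (by linarith) (by linarith),
        fract_of_pos (by linarith) (by linarith), fract_of_pos (by linarith) (by linarith)]
      simp only [m]
      push_cast
      congr 2
      ring
    · rintro w ⟨hw0, hw1⟩
      rw [starIntegrand, W_eq, Wbar_eq, Wbar_eq, exp_phase_combine, chord_sub_comm y,
        chord_sub_comm x, fract_of_neg (t := y - w) (by linarith) (by linarith),
        fract_of_pos (t := x - w) (by linarith) (by linarith),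
        fract_of_pos (t := w) (by linarith) (by linarith)]
      simp only [m, ← Complex.exp_add]
      push_cast
      congr 2
      ring
    · rintro w ⟨hw0, hw1⟩
      rw [starIntegrand, W_eq, Wbar_eq, Wbar_eq, exp_phase_combine, chord_sub_comm y,
        chord_sub_comm x, fract_of_neg (t := y - w) (by linarith) (by linarith),
        fract_of_neg (t := x - w) (by linarith) (by linarith),
        fract_of_pos (t := w) (by linarith) (by linarith)]
      simp only [m, ← Complex.exp_add]
      push_cast
      congr 2
      ring

/-- Translating `w` by `z` and reducing `x - z`, `y - z` modulo `2π` leaves every weight unchanged,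
which brings the general case to `star_triangle_base`. -/
lemma star_triangle (hk : k ^ 2 + k' ^ 2 = 1) (hk' : k' ≠ 0)
    (hpq : 0 < (q.lam - p.lam).re) (hqr : 0 < (r.lam - q.lam).re)
    (hpr : (r.lam - p.lam).re < 1) {x y z : ℝ} (hxy : ∀ n : ℤ, x - y ≠ 2 * Real.pi * n)
    (hyz : ∀ n : ℤ, y - z ≠ 2 * Real.pi * n) (hxz : ∀ n : ℤ, x - z ≠ 2 * Real.pi * n) :
    IntervalIntegrable (fun w : ℝ => Wbar q r (y - w) * W p r (x - w) * Wbar p q (w - z))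
      volume 0 (2 * Real.pi) ∧
    (1 / (2 * Real.pi) : ℂ) * (∫ w in (0 : ℝ)..(2 * Real.pi),
        Wbar q r (y - w) * W p r (x - w) * Wbar p q (w - z)) =
      Rinf p q r * (W p q (x - y) * Wbar p r (y - z) * W q r (x - z)) := by
  have reduce : ∀ t : ℝ, (∀ n : ℤ, t ≠ 2 * Real.pi * n) → ∃ n : ℤ,
      0 < t - n * (2 * Real.pi) ∧ t - n * (2 * Real.pi) < 2 * Real.pi := by
    intro t ht
    refine ⟨⌊t / (2 * Real.pi)⌋, ?_, ?_⟩
    · refine lt_of_le_of_ne ?_ fun h => ht ⌊t / (2 * Real.pi)⌋ (by linarith)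
      have := Int.floor_le (t / (2 * Real.pi))
      rw [le_div_iff₀ Real.two_pi_pos] at this
      linarith
    · have := Int.lt_floor_add_one (t / (2 * Real.pi))
      rw [div_lt_iff₀ Real.two_pi_pos] at this
      linarith
  obtain ⟨n, hn0, hn1⟩ := reduce _ hyz
  obtain ⟨l, hl0, hl1⟩ := reduce _ hxz
  have hne : x - z - l * (2 * Real.pi) ≠ y - z - n * (2 * Real.pi) := by
    intro h
    refine hxy (l - n) ?_
    push_cast
    linarith
  obtain ⟨hi, hI⟩ := star_triangle_base hk hk' hpq hqr hpr hl0 hl1 hn0 hn1 hne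
  have hF : (fun w : ℝ => Wbar q r (y - w) * W p r (x - w) * Wbar p q (w - z)) =
      fun w => starIntegrand p q r (x - z - l * (2 * Real.pi)) (y - z - n * (2 * Real.pi)) (w - z) := by
    funext w
    rw [starIntegrand, show y - z - n * (2 * Real.pi) - (w - z) = y - w - n * (2 * Real.pi) by ring,
      show x - z - l * (2 * Real.pi) - (w - z) = x - w - l * (2 * Real.pi) by ring,
      (Wbar_periodic q r).sub_int_mul_eq, (W_periodic p r).sub_int_mul_eq]
  have hper : Function.Periodic (starIntegrand p q r (x - z - l * (2 * Real.pi))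
      (y - z - n * (2 * Real.pi))) (2 * Real.pi) := by
    intro w
    simp only [starIntegrand, ← sub_sub]
    rw [(Wbar_periodic q r).sub_eq, (W_periodic p r).sub_eq, Wbar_periodic p q w]
  rw [hF]
  constructor
  · have := (hper.intervalIntegrable₀ Real.two_pi_pos.ne' hi (0 - z) (2 * Real.pi - z)).comp_sub_right z
    simpa using this
  · rw [intervalIntegral.integral_comp_sub_right]
    have := hper.intervalIntegral_add_eq (0 - z) 0
    rw [zero_add, show 0 - z + 2 * Real.pi = 2 * Real.pi - z by ring] at this
    rw [this, hI, (Wbar_periodic p r).sub_int_mul_eq, (W_periodic q r).sub_int_mul_eq,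
      show x - z - l * (2 * Real.pi) - (y - z - n * (2 * Real.pi)) = x - y - ((l - n : ℤ) : ℝ) * (2 * Real.pi) by
        push_cast; ring, (W_periodic p q).sub_int_mul_eq]

end StarTriangle
end ChiralPotts

/-! ### Integrability of chord powers and decay of their Fourier integrals -/

namespace ChiralPotts
open Set Filter Asymptotics

lemma chord_pos {x : ℝ} (h0 : 0 < x) (h1 : x < 2 * Real.pi) : 0 < chord x := by
  rw [chord_eq_sin h0.le h1.le]
  exact sin_half_pos h0 h1

lemma continuous_chord : Continuous chord := by
  unfold chord
  fun_prop

lemma measurable_chord_cpow (s : ℂ) : Measurable fun x : ℝ => (chord x : ℂ) ^ s :=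
  (Complex.measurable_ofReal.comp continuous_chord.measurable).pow_const s

lemma div_pi_le_chord {x : ℝ} (h0 : 0 ≤ x) (h1 : x ≤ Real.pi) : x / Real.pi ≤ chord x := by
  have := Real.mul_le_sin (x := x / 2) (by linarith) (by linarith)
  rw [chord_eq_sin h0 (by linarith [Real.pi_pos])]
  calc x / Real.pi = 2 / Real.pi * (x / 2) := by ring
    _ ≤ _ := this

/-- Jordan's inequality compares the chord with `x / π` on the first half period, and the reflection
`x ↦ 2π - x` gives the second half. -/
lemma intervalIntegrable_chord_cpow {s : ℂ} (h0 : -1 < s.re) (h1 : s.re < 0) :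
    IntervalIntegrable (fun x : ℝ => (chord x : ℂ) ^ s) volume 0 (2 * Real.pi) := by
  have hl : IntervalIntegrable (fun x : ℝ => (chord x : ℂ) ^ s) volume 0 Real.pi := by
    have hb := (intervalIntegral.intervalIntegrable_rpow' (a := 0) (b := Real.pi) h0).const_mul
      (Real.pi ^ (-s.re))
    refine hb.mono_fun (measurable_chord_cpow s).aestronglyMeasurable ?_
    rw [uIoc_of_le Real.pi_pos.le]
    filter_upwards [ae_restrict_mem measurableSet_Ioc] with x hx
    have hc := chord_pos hx.1 (by linarith [hx.2, Real.pi_pos])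
    have hx0 : 0 < x := hx.1
    rw [Complex.norm_cpow_eq_rpow_re_of_pos hc]
    calc chord x ^ s.re ≤ (x / Real.pi) ^ s.re :=
          Real.rpow_le_rpow_of_nonpos (div_pos hx.1 Real.pi_pos) (div_pi_le_chord hx.1.le hx.2) h1.le
      _ = Real.pi ^ (-s.re) * x ^ s.re := by
          rw [Real.div_rpow hx.1.le Real.pi_pos.le, Real.rpow_neg Real.pi_pos.le]
          ring
      _ ≤ _ := le_abs_self _
  refine hl.trans ?_
  have := hl.comp_sub_left (2 * Real.pi)
  rw [sub_zero, show 2 * Real.pi - Real.pi = Real.pi by ring] at this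
  refine this.symm.congr ?_
  intro x _
  simp only
  rw [chord_sub_comm, chord_periodic.sub_eq]

/-- `∫₀^{2π} e^{cx} |sin (x / 2)|^s dx`. -/
noncomputable def chordIntegral (c s : ℂ) : ℂ :=
  ∫ x in (0 : ℝ)..(2 * Real.pi), Complex.exp (c * x) * (chord x : ℂ) ^ s

lemma intervalIntegrable_exp_mul_chord {s : ℂ} (h0 : -1 < s.re) (h1 : s.re < 0) (c : ℂ) :
    IntervalIntegrable (fun x : ℝ => Complex.exp (c * x) * (chord x : ℂ) ^ s) volume 0
      (2 * Real.pi) :=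
  (intervalIntegrable_chord_cpow h0 h1).continuousOn_mul (by fun_prop)

/-- The function `e^{(μ + i/2)x} |sin (x/2)|^{s+1}` vanishes at both ends of the period. Its
derivative is a combination of the integrands at `μ + i` and `μ`, because `e^{ix/2}` times the sine
or cosine of `x / 2` is affine in `e^{ix}`. -/
lemma chordIntegral_recurrence {s : ℂ} (h0 : -1 < s.re) (h1 : s.re < 0) (μ : ℂ) :
    chordIntegral (μ + Complex.I) s * (2 * Complex.I * μ - s - 2) =
      chordIntegral μ s * (2 * Complex.I * μ + s) := by
  have hs1 : s + 1 ≠ 0 := fun h => by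
    have := congrArg Complex.re h
    simp at this
    linarith
  have hre : 0 < (s + 1).re := by simp; linarith
  have key := intervalIntegral.integral_eq_sub_of_hasDerivAt_of_le Real.two_pi_pos.le
    (f := fun x : ℝ => Complex.exp ((μ + Complex.I / 2) * x) * (chord x : ℂ) ^ (s + 1))
    (f' := fun x : ℝ => ((μ + Complex.I / 2) / (2 * Complex.I) + (s + 1) / 4) *
        (Complex.exp ((μ + Complex.I) * x) * (chord x : ℂ) ^ s) -
      ((μ + Complex.I / 2) / (2 * Complex.I) - (s + 1) / 4) *
        (Complex.exp (μ * x) * (chord x : ℂ) ^ s)) ?_ ?_ ?_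
  · rw [intervalIntegral.integral_sub
      ((intervalIntegrable_exp_mul_chord h0 h1 _).const_mul _)
      ((intervalIntegrable_exp_mul_chord h0 h1 _).const_mul _),
      intervalIntegral.integral_const_mul, intervalIntegral.integral_const_mul] at key
    have hz : chord (2 * Real.pi) = 0 := by simp [chord]
    have hz' : chord 0 = 0 := by simp [chord]
    rw [hz, hz', Complex.ofReal_zero, Complex.zero_cpow hs1, mul_zero, mul_zero, sub_zero] at key
    change _ * chordIntegral _ s - _ * chordIntegral _ s = 0 at key
    have hI : Complex.I ^ 2 = -1 := Complex.I_sq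
    field_simp at key
    linear_combination (Complex.I / 4) * key -
      ((2 + s) * chordIntegral (μ + Complex.I) s + s * chordIntegral μ s) * hI
  · refine ContinuousOn.mul (by fun_prop) ?_
    refine Continuous.continuousOn ?_
    refine continuous_iff_continuousAt.2 fun x => ?_
    exact ContinuousAt.comp (f := fun x : ℝ => (chord x : ℂ)) (g := fun z : ℂ => z ^ (s + 1))
      (Complex.continuousAt_cpow_const_of_re_pos (by simp [chord_nonneg]) hre)
      (Complex.continuous_ofReal.comp continuous_chord).continuousAt
  · rintro x ⟨hx0, hx1⟩
    have hpos := sin_half_pos hx0 hx1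
    have d1 : HasDerivAt (fun x : ℝ => Complex.exp ((μ + Complex.I / 2) * x))
        (Complex.exp ((μ + Complex.I / 2) * x) * ((μ + Complex.I / 2) * 1)) x :=
      (((hasDerivAt_id x).ofReal_comp).const_mul _).cexp
    have d2 : HasDerivAt (fun x : ℝ => ((Real.sin (x / 2) : ℝ) : ℂ) ^ (s + 1))
        ((s + 1) * ((Real.sin (x / 2) : ℝ) : ℂ) ^ (s + 1 - 1) *
          ((Real.cos (x / 2) * (1 / 2) : ℝ) : ℂ)) x := by
      have i1 : HasDerivAt (fun x : ℝ => ((Real.sin (x / 2) : ℝ) : ℂ))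
          ((Real.cos (x / 2) * (1 / 2) : ℝ) : ℂ) x :=
        (((hasDerivAt_id x).div_const 2).sin).ofReal_comp
      have i2 := (hasDerivAt_id ((Real.sin (x / 2) : ℝ) : ℂ)).cpow_const (c := s + 1)
        (Complex.ofReal_mem_slitPlane.2 hpos)
      rw [mul_one] at i2
      exact HasDerivAt.comp x i2 i1
    have d3 := d1.mul d2
    have hev : (fun x : ℝ => Complex.exp ((μ + Complex.I / 2) * x) * (chord x : ℂ) ^ (s + 1))
        =ᶠ[nhds x] fun x : ℝ => Complex.exp ((μ + Complex.I / 2) * x) *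
          ((Real.sin (x / 2) : ℝ) : ℂ) ^ (s + 1) := by
      filter_upwards [Ioo_mem_nhds hx0 hx1] with t ht
      rw [chord_eq_sin ht.1.le ht.2.le]
    refine (d3.congr_of_eventuallyEq hev).congr_deriv ?_
    rw [chord_eq_sin hx0.le hx1.le, add_sub_cancel_right,
      Complex.cpow_add _ _ (by exact_mod_cast hpos.ne'), Complex.cpow_one]
    have e1 : Complex.exp ((μ + Complex.I / 2) * x) =
        Complex.exp (μ * x) * Complex.exp (Complex.I * (x / 2)) := by
      rw [← Complex.exp_add]; congr 1; ring
    have e2 : Complex.exp ((μ + Complex.I) * x) =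
        Complex.exp (μ * x) * Complex.exp (Complex.I * (x / 2)) ^ 2 := by
      rw [← Complex.exp_nat_mul, ← Complex.exp_add]; congr 1; push_cast; ring
    have e3 : Complex.exp (Complex.I * (x / 2)) = Complex.cos (x / 2) + Complex.sin (x / 2) * Complex.I := by
      rw [mul_comm, Complex.exp_mul_I]
    have e4 := Complex.sin_sq_add_cos_sq ((x : ℂ) / 2)
    rw [e1, e2, e3]
    push_cast
    generalize Complex.cos ((x : ℂ) / 2) = C at *
    generalize Complex.sin ((x : ℂ) / 2) = S at *
    generalize Complex.exp (μ * x) = E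
    generalize S ^ s = P
    have hI : Complex.I ^ 2 = -1 := Complex.I_sq
    have hinv : (μ + Complex.I / 2) / (2 * Complex.I) = -(Complex.I / 2) * (μ + Complex.I / 2) := by
      rw [div_eq_iff two_I_ne_zero]
      linear_combination (μ + Complex.I / 2) * hI
    have q1 : (C + S * Complex.I) ^ 2 - 1 = 2 * Complex.I * S * (C + S * Complex.I) := by
      linear_combination e4 - S ^ 2 * hI
    have q2 : (C + S * Complex.I) ^ 2 + 1 = 2 * C * (C + S * Complex.I) := by
      linear_combination S ^ 2 * hI - e4
    rw [hinv]
    linear_combination E * P * (C + S * Complex.I) * (μ + Complex.I / 2) * S * hI +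
      E * P * (Complex.I / 2) * (μ + Complex.I / 2) * q1 - E * P * (s + 1) / 4 * q2
  · exact ((intervalIntegrable_exp_mul_chord h0 h1 _).const_mul _).sub
      ((intervalIntegrable_exp_mul_chord h0 h1 _).const_mul _)

/-- The ratio is `n^{u - v}` times a quotient of Euler approximants `GammaSeq`, which converges to
`Γ(v) / Γ(u)` and is therefore bounded. -/
lemma prod_ratio_isBigO {u v : ℂ} (hu : 0 < u.re) (hv : 0 < v.re) :
    (fun n : ℕ => (∏ j ∈ Finset.range (n + 1), (u + j)) / ∏ j ∈ Finset.range (n + 1), (v + j))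
      =O[atTop] fun n : ℕ => (n : ℝ) ^ (u.re - v.re) := by
  have hlim := (Complex.GammaSeq_tendsto_Gamma v).div (Complex.GammaSeq_tendsto_Gamma u)
    (Complex.Gamma_ne_zero_of_re_pos hu)
  have hpow : (fun n : ℕ => (n : ℂ) ^ (u - v)) =O[atTop] fun n : ℕ => (n : ℝ) ^ (u.re - v.re) := by
    refine IsBigO.of_norm_eventuallyLE ?_
    filter_upwards [eventually_gt_atTop 0] with n hn
    rw [Complex.norm_natCast_cpow_of_pos hn, Complex.sub_re]
  have key := hpow.mul (hlim.isBigO_one ℝ)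
  simp only [mul_one] at key
  refine key.congr' ?_ EventuallyEq.rfl
  filter_upwards [eventually_gt_atTop 0] with n hn
  have hn' : (n : ℂ) ≠ 0 := by exact_mod_cast hn.ne'
  have hprod : ∀ {w : ℂ}, 0 < w.re → ∏ j ∈ Finset.range (n + 1), (w + j) ≠ 0 := by
    intro w hw
    refine Finset.prod_ne_zero_iff.2 fun j _ h => ?_
    have := congrArg Complex.re h
    simp at this
    have : (0 : ℝ) ≤ j := Nat.cast_nonneg j
    linarith
  have h1 := hprod hu
  have h2 := hprod hv
  have h3 : (n : ℂ) ^ u ≠ 0 := by simp [Complex.cpow_eq_zero_iff, hn']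
  have h4 : (n : ℂ) ^ v ≠ 0 := by simp [Complex.cpow_eq_zero_iff, hn']
  have h5 : (n.factorial : ℂ) ≠ 0 := by exact_mod_cast n.factorial_ne_zero
  simp only [Pi.div_apply, Complex.GammaSeq]
  rw [Complex.cpow_sub _ _ hn']
  field_simp

/-- Decay of a solution of a first-order hypergeometric recurrence. -/
lemma isBigO_of_recurrence {b : ℕ → ℂ} {w s : ℂ}
    (h : ∀ n : ℕ, b (n + 1) * (n + 1 + w + s / 2) = b n * (n + w - s / 2)) :
    ∀ᶠ N in atTop, (fun n : ℕ => b (n + N + 1)) =O[atTop] fun n : ℕ => (n : ℝ) ^ (-1 - s.re) := by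
  have hev : ∀ r : ℝ, ∀ᶠ N : ℕ in atTop, 0 < (N : ℝ) + r := fun r => by
    filter_upwards [tendsto_natCast_atTop_atTop.eventually_gt_atTop (-r)] with N hN
    linarith
  -- Starting the recurrence at a large `N` puts both parameters in the right half plane, so no
  -- denominator vanishes.
  filter_upwards [hev ((w - s / 2).re), hev ((1 + w + s / 2).re)] with N hN1 hN2
  have hu : 0 < ((N : ℂ) + (w - s / 2)).re := by simpa using hN1
  have hv : 0 < ((N : ℂ) + (1 + w + s / 2)).re := by simpa using hN2
  have hne : ∀ j : ℕ, (N : ℂ) + (1 + w + s / 2) + j ≠ 0 := by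
    intro j hj
    have := congrArg Complex.re hj
    rw [Complex.add_re, Complex.natCast_re, Complex.zero_re] at this
    have : (0 : ℝ) ≤ j := Nat.cast_nonneg j
    linarith
  have hstep : ∀ n : ℕ, b (n + N) = b N *
      ((∏ j ∈ Finset.range n, ((N : ℂ) + (w - s / 2) + j)) /
        ∏ j ∈ Finset.range n, ((N : ℂ) + (1 + w + s / 2) + j)) := by
    intro n
    induction n with
    | zero => simp
    | succ n ih =>
      have h1 := h (n + N)
      rw [show n + 1 + N = n + N + 1 by ring, Finset.prod_range_succ, Finset.prod_range_succ,
        mul_div_mul_comm, ← mul_assoc, ← ih, mul_div_assoc', eq_div_iff (hne n)]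
      push_cast at h1
      linear_combination h1
  have hb := (prod_ratio_isBigO hu hv).const_mul_left (b N)
  have hre : ((N : ℂ) + (w - s / 2)).re - ((N : ℂ) + (1 + w + s / 2)).re = -1 - s.re := by
    simp
    ring
  rw [hre] at hb
  refine hb.congr_left fun n => ?_
  rw [← hstep (n + 1)]
  congr 1
  ring

lemma chordIntegral_isBigO_pos {s : ℂ} (h0 : -1 < s.re) (h1 : s.re < 0) (c : ℂ) :
    ∀ᶠ N in atTop, (fun n : ℕ => chordIntegral (c + Complex.I * (n + N + 1 : ℕ)) s)
      =O[atTop] fun n : ℕ => (n : ℝ) ^ (-1 - s.re) := by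
  refine isBigO_of_recurrence (b := fun n : ℕ => chordIntegral (c + Complex.I * n) s)
    (w := -Complex.I * c) fun n => ?_
  have := chordIntegral_recurrence h0 h1 (c + Complex.I * n)
  have hI : Complex.I ^ 2 = -1 := Complex.I_sq
  rw [show c + Complex.I * ((n + 1 : ℕ) : ℂ) = c + Complex.I * n + Complex.I by push_cast; ring]
  linear_combination (-1 / 2) * this + n *
    (chordIntegral (c + Complex.I * n + Complex.I) s - chordIntegral (c + Complex.I * n) s) * hI

lemma chordIntegral_isBigO_neg {s : ℂ} (h0 : -1 < s.re) (h1 : s.re < 0) (c : ℂ) :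
    ∀ᶠ N in atTop, (fun n : ℕ => chordIntegral (c - Complex.I * (n + N + 1 : ℕ)) s)
      =O[atTop] fun n : ℕ => (n : ℝ) ^ (-1 - s.re) := by
  refine isBigO_of_recurrence (b := fun n : ℕ => chordIntegral (c - Complex.I * n) s)
    (w := Complex.I * c) fun n => ?_
  have := chordIntegral_recurrence h0 h1 (c - Complex.I * (n + 1))
  have hI : Complex.I ^ 2 = -1 := Complex.I_sq
  rw [show c - Complex.I * (n + 1) + Complex.I = c - Complex.I * n by ring] at this
  push_cast
  linear_combination (-1 / 2) * this + (n + 1) *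
    (chordIntegral (c - Complex.I * (n + 1)) s - chordIntegral (c - Complex.I * n) s) * hI

lemma summable_of_isBigO_shift {a b : ℕ → ℂ} {σ τ : ℝ} (hστ : -1 < σ + τ)
    (ha : ∀ᶠ N in atTop, (fun n : ℕ => a (n + N + 1)) =O[atTop] fun n : ℕ => (n : ℝ) ^ (-1 - σ))
    (hb : ∀ᶠ N in atTop, (fun n : ℕ => b (n + N + 1)) =O[atTop] fun n : ℕ => (n : ℝ) ^ (-1 - τ)) :
    Summable fun n => a n * b n := by
  obtain ⟨N, hN1, hN2⟩ := (ha.and hb).exists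
  rw [← summable_nat_add_iff (N + 1)]
  refine summable_of_isBigO_nat (g := fun n : ℕ => (n : ℝ) ^ (-2 - σ - τ))
    (Real.summable_nat_rpow.2 (by linarith)) ?_
  refine (hN1.mul hN2).congr' (Eventually.of_forall fun n => by simp only [add_assoc]) ?_
  filter_upwards [eventually_gt_atTop 0] with n hn
  rw [← Real.rpow_add (by exact_mod_cast hn)]
  congr 1
  ring

/-- The decay bound for a single factor, `|e|^{-1 - Re s}`, is not summable since `Re s < 0`; the
product is bounded by `|e|^{-2 - Re s - Re t}`, which is summable because `Re s + Re t > -1`. -/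
lemma summable_chordIntegral_mul {s t : ℂ} (hs0 : -1 < s.re) (hs1 : s.re < 0)
    (ht0 : -1 < t.re) (ht1 : t.re < 0) (hst : -1 < s.re + t.re) (c d : ℂ) :
    Summable fun e : ℤ => chordIntegral (c - Complex.I * e) s *
      chordIntegral (d + Complex.I * e) t := by
  refine Summable.of_nat_of_neg ?_ ?_
  · exact summable_of_isBigO_shift (σ := s.re) (τ := t.re) hst
      (a := fun n : ℕ => chordIntegral (c - Complex.I * n) s)
      (b := fun n : ℕ => chordIntegral (d + Complex.I * n) t)
      (chordIntegral_isBigO_neg hs0 hs1 c) (chordIntegral_isBigO_pos ht0 ht1 d)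
  · refine (summable_of_isBigO_shift (σ := s.re) (τ := t.re) hst
      (a := fun n : ℕ => chordIntegral (c + Complex.I * n) s)
      (b := fun n : ℕ => chordIntegral (d - Complex.I * n) t)
      (chordIntegral_isBigO_pos hs0 hs1 c) (chordIntegral_isBigO_neg ht0 ht1 d)).congr fun n => ?_
    congr 2 <;> push_cast <;> ring

end ChiralPotts

/-! ### Fourier analysis of integrable functions on the circle -/

namespace ChiralPotts
open Set Filter

section Circle

open AddCircle

variable {T : ℝ}

lemma fourier_add_arg (n : ℤ) (x y : AddCircle T) :
    fourier n (x + y) = fourier n x * fourier n y := by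
  simp [fourier_apply, smul_add, toCircle_add]

lemma fourier_neg_arg (n : ℤ) (x : AddCircle T) : fourier n (-x) = fourier (-n) x := by
  simp [fourier_apply]

variable [hT : Fact (0 < T)]

local notation "μT" => (haarAddCircle (T := T))

/-- Integration of continuous functions against an integrable function. -/
noncomputable def pairing (F : AddCircle T → ℂ) (hF : Integrable F μT) :
    C(AddCircle T, ℂ) →L[ℂ] ℂ :=
  LinearMap.mkContinuous
    { toFun := fun φ => ∫ x, φ x * F x ∂μT
      map_add' := fun φ ψ => by
        simp only [ContinuousMap.add_apply, add_mul]
        exact integral_add (hF.bdd_mul φ.continuous.aestronglyMeasurable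
          (Eventually.of_forall φ.norm_coe_le_norm)) (hF.bdd_mul ψ.continuous.aestronglyMeasurable
          (Eventually.of_forall ψ.norm_coe_le_norm))
      map_smul' := fun c φ => by
        simp only [ContinuousMap.smul_apply, smul_eq_mul, mul_assoc, RingHom.id_apply]
        exact integral_const_mul _ _ }
    (∫ x, ‖F x‖ ∂μT) fun φ => by
      simp only [LinearMap.coe_mk, AddHom.coe_mk]
      calc ‖∫ x, φ x * F x ∂μT‖ ≤ ∫ x, ‖φ‖ * ‖F x‖ ∂μT := by
            refine norm_integral_le_of_norm_le (hF.norm.const_mul _) (Eventually.of_forall fun x => ?_)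
            rw [norm_mul]
            gcongr
            exact φ.norm_coe_le_norm x
        _ = _ := by rw [integral_const_mul, mul_comm]

lemma pairing_apply {F : AddCircle T → ℂ} (hF : Integrable F μT) (φ : C(AddCircle T, ℂ)) :
    pairing F hF φ = ∫ x, φ x * F x ∂μT := rfl

lemma pairing_fourier {F : AddCircle T → ℂ} (hF : Integrable F μT) (n : ℤ) :
    pairing F hF (fourier n) = fourierCoeff F (-n) := by
  simp [pairing_apply, fourierCoeff]

/-- An integrable function on the circle is determined by its Fourier coefficients. -/
lemma ae_eq_zero_of_fourierCoeff_eq_zero {F : AddCircle T → ℂ} (hF : Integrable F μT)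
    (h : ∀ n, fourierCoeff F n = 0) : F =ᵐ[μT] 0 := by
  have hL : pairing F hF = 0 := by
    -- The pairing kills all characters, hence by density every continuous function.
    have hle : (Submodule.span ℂ (range (@fourier T))).topologicalClosure ≤ (pairing F hF).ker := by
      refine Submodule.topologicalClosure_minimal _ ?_ (pairing F hF).isClosed_ker
      rw [Submodule.span_le]
      rintro _ ⟨n, rfl⟩
      simp [pairing_fourier, h]
    rw [span_fourier_closure_eq_top] at hle
    ext φ
    exact hle (Submodule.mem_top (x := φ))
  refine ae_eq_zero_of_forall_setIntegral_isClosed_eq_zero hF fun s hs => ?_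
  -- The indicator of a closed set is a bounded pointwise limit of continuous functions, so its
  -- integral against `F` is a limit of zeros.
  have hlim : Tendsto (fun n : ℕ => ∫ x, ((hs.apprSeq n x : ℝ) : ℂ) * F x ∂μT) atTop
      (nhds (∫ x in s, F x ∂μT)) := by
    rw [← integral_indicator hs.measurableSet]
    refine tendsto_integral_of_dominated_convergence (fun x => ‖F x‖) (fun n => ?_) hF.norm
      (fun n => Eventually.of_forall fun x => ?_) (Eventually.of_forall fun x => ?_)
    · refine AEStronglyMeasurable.mul ?_ hF.aestronglyMeasurable
      exact (Complex.continuous_ofReal.comp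
        (NNReal.continuous_coe.comp (hs.apprSeq n).continuous)).aestronglyMeasurable
    · rw [norm_mul, Complex.norm_real, NNReal.norm_eq]
      exact mul_le_of_le_one_left (norm_nonneg _)
        (by exact_mod_cast HasOuterApproxClosed.apprSeq_apply_le_one hs n x)
    · have h1 := tendsto_pi_nhds.1 (HasOuterApproxClosed.tendsto_apprSeq hs) x
      have h2 := ((Complex.continuous_ofReal.comp NNReal.continuous_coe).tendsto _).comp h1
      have h3 := h2.mul_const (F x)
      have h4 : (Complex.ofReal ∘ NNReal.toReal) (s.indicator (fun _ => 1) x) * F x =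
          s.indicator F x := by
        by_cases hx : x ∈ s <;> simp [hx]
      rw [h4] at h3
      exact h3
  refine tendsto_nhds_unique hlim ?_
  have hzero : ∀ n : ℕ, ∫ x, ((hs.apprSeq n x : ℝ) : ℂ) * F x ∂μT = 0 := fun n => by
    have := DFunLike.congr_fun hL (⟨fun x => ((hs.apprSeq n x : ℝ) : ℂ), Complex.continuous_ofReal.comp
        (NNReal.continuous_coe.comp (hs.apprSeq n).continuous)⟩ : C(AddCircle T, ℂ))
    exact this
  simp only [hzero]
  exact tendsto_const_nhds

lemma integrable_comp_sub_mul {f h : AddCircle T → ℂ} (hf : Integrable f μT)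
    (hh : Integrable h μT) :
    Integrable (fun z : AddCircle T × AddCircle T => f (z.1 - z.2) * h z.1) ((μT).prod μT) := by
  have hmp := (measurePreserving_prod_add μT μT).comp (measurePreserving_sub_prod μT μT)
  have := hmp.integrable_comp_of_integrable (hf.mul_prod hh)
  refine this.congr (Eventually.of_forall fun z => ?_)
  simp

/-- Fubini and the substitution `y ↦ x - y` separate the variables; since this is a correlation
rather than a convolution, `f` enters at `-j`. -/
lemma fourierCoeff_corr {f h : AddCircle T → ℂ} (hf : Integrable f μT)
    (hh : Integrable h μT) (j : ℤ) :
    fourierCoeff (fun y => ∫ x, f (x - y) * h x ∂μT) j = fourierCoeff f (-j) * fourierCoeff h j := by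
  have hint := integrable_comp_sub_mul hf hh
  have hb : Integrable (fun z : AddCircle T × AddCircle T =>
      fourier (-j) z.2 * (f (z.1 - z.2) * h z.1)) ((μT).prod μT) :=
    hint.bdd_mul (c := 1) ((fourier (-j)).continuous.comp continuous_snd).aestronglyMeasurable
      (Eventually.of_forall fun z => by rw [fourier_apply, Circle.norm_coe])
  calc fourierCoeff (fun y => ∫ x, f (x - y) * h x ∂μT) j
      = ∫ y, ∫ x, fourier (-j) y * (f (x - y) * h x) ∂μT ∂μT := by
        rw [fourierCoeff]
        congr 1
        ext y
        rw [smul_eq_mul, integral_const_mul]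
    _ = ∫ x, ∫ y, fourier (-j) y * (f (x - y) * h x) ∂μT ∂μT :=
        (integral_integral_swap hb).symm
    _ = ∫ x, fourierCoeff f (-j) * (fourier (-j) x * h x) ∂μT := by
        congr 1
        ext x
        have h1 : ∀ y, fourier (-j) y * (f (x - y) * h x) =
            (fourier j (x - y) * f (x - y)) * (fourier (-j) x * h x) := by
          intro y
          have h2 : (fourier j (x - y) : ℂ) * fourier (-j) x = fourier (-j) y := by
            rw [sub_eq_add_neg, fourier_add_arg, fourier_neg_arg, mul_right_comm, ← fourier_add]
            simp
          rw [← h2]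
          ring
        simp only [h1]
        rw [integral_mul_const, integral_sub_left_eq_self (fun u => fourier j u * f u) μT x]
        simp [fourierCoeff]
    _ = _ := by
        rw [integral_const_mul]
        rfl

/-- An integrable function with summable Fourier coefficients is the sum of its Fourier series. -/
lemma ae_eq_tsum_of_summable {F : AddCircle T → ℂ} (hF : Integrable F μT)
    (hs : Summable (fourierCoeff F)) :
    F =ᵐ[μT] ⇑(∑' j : ℤ, fourierCoeff F j • (fourier j : C(AddCircle T, ℂ))) := by
  have hS : Summable fun j : ℤ => fourierCoeff F j • (fourier j : C(AddCircle T, ℂ)) := by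
    refine Summable.of_norm ?_
    simpa [norm_smul, fourier_norm] using hs.norm
  set S : C(AddCircle T, ℂ) := ∑' j : ℤ, fourierCoeff F j • (fourier j : C(AddCircle T, ℂ))
  have hSi : Integrable S μT := by
    simpa using S.continuous.continuousOn.integrableOn_compact isCompact_univ
  have hcoef : ∀ n, fourierCoeff S n = fourierCoeff F n := by
    intro n
    have hi : Integrable (fourier (-n) : C(AddCircle T, ℂ)) μT := by
      simpa using (fourier (-n)).continuous.continuousOn.integrableOn_compact isCompact_univ
    -- Pairing with `fourier (-n)` is a continuous functional, so the coefficient of the sum is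
    -- computed termwise.
    have h1 := (pairing _ hi).hasSum hS.hasSum
    have h2 : ∀ j, pairing _ hi (fourierCoeff F j • (fourier j : C(AddCircle T, ℂ))) =
        if j = n then fourierCoeff F n else 0 := by
      intro j
      rw [map_smul, pairing_fourier, fourierCoeff_fourier]
      by_cases hj : j = n
      · simp [hj]
      · have : (-j : ℤ) ≠ -n := by simpa using hj
        simp [hj, this]
    simp only [h2] at h1
    have h3 := h1.unique (hasSum_ite_eq n (fourierCoeff F n))
    rw [← h3, pairing_apply, fourierCoeff]
    congr 1
    ext x
    rw [smul_eq_mul, mul_comm]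
  have := ae_eq_zero_of_fourierCoeff_eq_zero (F := F - ⇑S) (hF.sub hSi) fun n => by
    have := hcoef n
    rw [fourierCoeff] at this ⊢
    simp only [Pi.sub_apply, smul_sub]
    rw [integral_sub (hF.fourier_smul _) (hSi.fourier_smul _), this, fourierCoeff, sub_self]
  filter_upwards [this] with x hx
  simpa [sub_eq_zero] using hx

/-- Integrating out `x` gives a correlation `F` of `f` and the twisted `h`. Summability makes `F` a
uniform limit of its Fourier series, so `g` only has to be integrable for termwise integration. -/
lemma hasSum_fourierCoeff_triple {f g h : AddCircle T → ℂ} (hf : Integrable f μT)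
    (hg : Integrable g μT) (hh : Integrable h μT)
    (hK : Integrable (fun z : AddCircle T × AddCircle T => f (z.1 - z.2) * g z.2 * h z.1)
      ((μT).prod μT)) (m n : ℤ)
    (hs : Summable fun e : ℤ => fourierCoeff f e * fourierCoeff h (m - e)) :
    HasSum (fun e : ℤ => fourierCoeff f e * fourierCoeff g (n + e) * fourierCoeff h (m - e))
      (∫ z, fourier (-m) z.1 * fourier (-n) z.2 * (f (z.1 - z.2) * g z.2 * h z.1)
        ∂((μT).prod μT)) := by
  have hh' : Integrable (fun x => fourier (-m) x • h x) μT := hh.fourier_smul _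
  have hg' : Integrable (fun x => fourier (-n) x • g x) μT := hg.fourier_smul _
  set F : AddCircle T → ℂ := fun y => ∫ x, f (x - y) * (fourier (-m) x • h x) ∂μT with hFdef
  have hF : Integrable F μT := (integrable_comp_sub_mul hf hh').integral_prod_right
  have hc : ∀ j, fourierCoeff F j = fourierCoeff f (-j) * fourierCoeff h (m + j) := by
    intro j
    rw [hFdef, fourierCoeff_corr hf hh']
    congr 1
    rw [fourierCoeff, fourierCoeff]
    congr 1
    ext x
    rw [smul_smul, ← fourier_add]
    congr 3
    ring
  have hs' : Summable (fourierCoeff F) := by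
    have := (Equiv.neg ℤ).summable_iff.2 hs
    refine this.congr fun j => ?_
    rw [hc]
    simp
  have hS : Summable fun j : ℤ => fourierCoeff F j • (fourier j : C(AddCircle T, ℂ)) := by
    refine Summable.of_norm ?_
    simpa [norm_smul, fourier_norm] using hs'.norm
  have hae := ae_eq_tsum_of_summable hF hs'
  have hKb : Integrable (fun z : AddCircle T × AddCircle T =>
      fourier (-m) z.1 * fourier (-n) z.2 * (f (z.1 - z.2) * g z.2 * h z.1)) ((μT).prod μT) :=
    hK.bdd_mul (c := 1) (((fourier (-m)).continuous.comp continuous_fst).mul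
      ((fourier (-n)).continuous.comp continuous_snd)).aestronglyMeasurable
      (Eventually.of_forall fun z => by rw [norm_mul, fourier_apply, fourier_apply, Circle.norm_coe, Circle.norm_coe, one_mul])
  have hint : ∫ z, fourier (-m) z.1 * fourier (-n) z.2 * (f (z.1 - z.2) * g z.2 * h z.1)
      ∂((μT).prod μT) = pairing _ hg' (∑' j : ℤ, fourierCoeff F j • (fourier j : C(AddCircle T, ℂ))) := by
    rw [integral_prod_symm _ hKb, pairing_apply]
    refine integral_congr_ae ?_
    filter_upwards [hae] with y hy
    rw [← hy, hFdef]
    simp only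
    rw [← integral_mul_const]
    congr 1
    ext x
    simp only [smul_eq_mul]
    ring
  rw [hint]
  have hsum := (pairing _ hg').hasSum hS.hasSum
  rw [← (Equiv.neg ℤ).hasSum_iff] at hsum
  convert hsum using 1
  ext e
  simp only [Function.comp_apply, Equiv.neg_apply, map_smul, pairing_fourier, hc, neg_neg,
    smul_eq_mul, ← sub_eq_add_neg]
  have hge : fourierCoeff (fun x => fourier (-n) x * g x) e = fourierCoeff g (n + e) := by
    rw [fourierCoeff, fourierCoeff]
    congr 1
    ext x
    rw [smul_eq_mul, smul_eq_mul, ← mul_assoc, ← fourier_add]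
    congr 3
    ring
  rw [hge]
  ring

/-- The Fourier transform of a product identity of star-triangle type. -/
lemma hasSum_dual {f g h A B C : AddCircle T → ℂ} (hf : Integrable f μT)
    (hg : Integrable g μT) (hh : Integrable h μT) (hA : Integrable A μT)
    (hB : Integrable B μT) (hC : Integrable C μT) {R : ℂ} (hR : R ≠ 0)
    (hstar : ∀ᵐ z ∂((μT).prod μT), ∫ w, A (z.2 - w) * B (z.1 - w) * C w ∂μT =
      R * (f (z.1 - z.2) * g z.2 * h z.1)) (m n : ℤ)
    (hs : Summable fun e : ℤ => fourierCoeff f e * fourierCoeff h (m - e)) :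
    HasSum (fun e : ℤ => fourierCoeff f e * fourierCoeff g (n + e) * fourierCoeff h (m - e))
      (1 / R * (fourierCoeff A n * fourierCoeff B m * fourierCoeff C (m + n))) := by
  -- The shear `(w, z) ↦ (w, z - (w, w))` preserves the measure and makes the left integrand a pure
  -- product.
  have hmp : MeasurePreserving (fun p : AddCircle T × (AddCircle T × AddCircle T) =>
      (p.1, p.2 - (p.1, p.1))) ((μT).prod ((μT).prod μT)) ((μT).prod ((μT).prod μT)) := by
    refine MeasurePreserving.skew_product (f := id) (MeasurePreserving.id _)
      (g := fun w z => z - (w, w))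
      (Continuous.measurable (by unfold Function.uncurry; fun_prop)) (Eventually.of_forall fun w => ?_)
    exact map_sub_right_eq_self _ _
  have hΨ : ∀ {A B C : AddCircle T → ℂ}, Integrable A μT → Integrable B μT → Integrable C μT →
      Integrable (fun p : AddCircle T × (AddCircle T × AddCircle T) =>
        A (p.2.2 - p.1) * B (p.2.1 - p.1) * C p.1) ((μT).prod ((μT).prod μT)) := by
    intro A B C hA hB hC
    refine (hmp.integrable_comp_of_integrable (hC.mul_prod (hB.mul_prod hA))).congr
      (Eventually.of_forall fun p => ?_)
    simp only [Function.comp_apply, Prod.fst_sub, Prod.snd_sub]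
    ring
  -- Joint integrability of the right side is inherited from the left: up to the factor `R` it is a
  -- marginal of an integrable function of three variables.
  have hK : Integrable (fun z : AddCircle T × AddCircle T => f (z.1 - z.2) * g z.2 * h z.1)
      ((μT).prod μT) := by
    have := ((hΨ hA hB hC).integral_prod_right).const_mul (1 / R)
    refine this.congr ?_
    filter_upwards [hstar] with z hz
    simp only [hz]
    field_simp
  convert hasSum_fourierCoeff_triple hf hg hh hK m n hs using 1
  have hΦ := hΨ (hA.fourier_smul (-n)) (hB.fourier_smul (-m)) (hC.fourier_smul (-(m + n)))
  have e1 : ∫ z, fourier (-m) z.1 * fourier (-n) z.2 * (f (z.1 - z.2) * g z.2 * h z.1)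
      ∂((μT).prod μT) = 1 / R * ∫ z : AddCircle T × AddCircle T, ∫ w,
        (fourier (-n) (z.2 - w) • A (z.2 - w)) * (fourier (-m) (z.1 - w) • B (z.1 - w)) *
          (fourier (-(m + n)) w • C w) ∂μT ∂((μT).prod μT) := by
    rw [← integral_const_mul]
    refine integral_congr_ae ?_
    filter_upwards [hstar] with z hz
    have h1 : f (z.1 - z.2) * g z.2 * h z.1 =
        1 / R * ∫ w, A (z.2 - w) * B (z.1 - w) * C w ∂μT := by
      rw [hz]; field_simp
    rw [h1, mul_left_comm, ← integral_const_mul]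
    congr 2
    ext w
    -- The characters are split along the translation by `w`, so each of `A`, `B`, `C` receives its
    -- own character.
    have h2 : (fourier (-n) z.2 : ℂ) = fourier (-n) (z.2 - w) * fourier (-n) w := by
      rw [← fourier_add_arg, sub_add_cancel]
    have h3 : (fourier (-m) z.1 : ℂ) = fourier (-m) (z.1 - w) * fourier (-m) w := by
      rw [← fourier_add_arg, sub_add_cancel]
    have h4 : (fourier (-(m + n)) w : ℂ) = fourier (-m) w * fourier (-n) w := by
      rw [neg_add, fourier_add]
    rw [h2, h3, h4]
    simp only [smul_eq_mul]
    ring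
  rw [e1]
  congr 1
  rw [← integral_integral_swap (f := fun w (z : AddCircle T × AddCircle T) =>
    (fourier (-n) (z.2 - w) • A (z.2 - w)) * (fourier (-m) (z.1 - w) • B (z.1 - w)) *
          (fourier (-(m + n)) w • C w)) hΦ]
  have e2 : ∀ w : AddCircle T, ∫ z : AddCircle T × AddCircle T,
      (fourier (-n) (z.2 - w) • A (z.2 - w)) * (fourier (-m) (z.1 - w) • B (z.1 - w)) *
          (fourier (-(m + n)) w • C w) ∂((μT).prod μT) =
      fourierCoeff A n * fourierCoeff B m * (fourier (-(m + n)) w • C w) := by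
    intro w
    rw [integral_mul_const]
    congr 1
    have := integral_sub_right_eq_self (μ := (μT).prod μT) (fun z : AddCircle T × AddCircle T =>
      (fourier (-m) z.1 • B z.1) * (fourier (-n) z.2 • A z.2)) (w, w)
    rw [integral_prod_mul (fun x => fourier (-m) x • B x) (fun x => fourier (-n) x • A x)] at this
    rw [mul_comm (fourierCoeff A n), fourierCoeff, fourierCoeff, ← this]
    congr 1
    ext z
    simp only [Prod.fst_sub, Prod.snd_sub]
    ring
  simp only [e2]
  rw [integral_const_mul]
  rfl

end Circle
end ChiralPotts

/-! ### The weights as functions on the circle and the dual equation -/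

namespace ChiralPotts
variable {k k' : ℂ}
open Set Filter

section Weights

open AddCircle

lemma fact_two_pi_pos : Fact (0 < 2 * Real.pi) := ⟨Real.two_pi_pos⟩

attribute [local instance] fact_two_pi_pos

lemma measurable_weight (c s : ℂ) : Measurable fun x : ℝ =>
    Complex.exp (c * (Int.fract (x / (2 * Real.pi)) : ℝ)) * (chord x : ℂ) ^ s := by
  have := measurable_chord_cpow s
  fun_prop

lemma weight_eq_on_Ioo (c s : ℂ) {x : ℝ} (hx : x ∈ Ioo 0 (2 * Real.pi)) :
    Complex.exp (c * (Int.fract (x / (2 * Real.pi)) : ℝ)) * (chord x : ℂ) ^ s =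
      Complex.exp (c / (2 * Real.pi) * x) * (chord x : ℂ) ^ s := by
  rw [fract_of_pos hx.1 hx.2]
  congr 2
  push_cast
  ring

lemma intervalIntegrable_weight {s : ℂ} (h0 : -1 < s.re) (h1 : s.re < 0) (c : ℂ) :
    IntervalIntegrable (fun x : ℝ =>
      Complex.exp (c * (Int.fract (x / (2 * Real.pi)) : ℝ)) * (chord x : ℂ) ^ s)
      volume 0 (2 * Real.pi) := by
  have := intervalIntegrable_exp_mul_chord h0 h1 (c / (2 * Real.pi))
  rw [intervalIntegrable_iff_integrableOn_Ioo_of_le Real.two_pi_pos.le] at this ⊢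
  exact (integrableOn_congr_fun (fun x hx => weight_eq_on_Ioo c s hx) measurableSet_Ioo).2 this

lemma intervalIntegrable_W {p q : Rapidity k k'} (h0 : 0 < (q.lam - p.lam).re)
    (h1 : (q.lam - p.lam).re < 1) : IntervalIntegrable (W p q) volume 0 (2 * Real.pi) := by
  refine intervalIntegrable_weight ?_ ?_ _ <;> simp only [Complex.sub_re] at * <;> linarith

lemma intervalIntegrable_Wbar {p q : Rapidity k k'} (h0 : 0 < (q.lam - p.lam).re)
    (h1 : (q.lam - p.lam).re < 1) : IntervalIntegrable (Wbar p q) volume 0 (2 * Real.pi) := by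
  refine intervalIntegrable_weight ?_ ?_ _ <;>
    simp only [Complex.sub_re, Complex.one_re] at * <;> linarith

lemma fourierTransform_W (p q : Rapidity k k') (j : ℤ) : fourierTransform (W p q) j =
    1 / (2 * Real.pi) * chordIntegral ((p.γ - q.γ) / (2 * Real.pi) - Complex.I * j)
      (p.lam - q.lam) := by
  rw [fourierTransform, chordIntegral, intervalIntegral.integral_of_le Real.two_pi_pos.le,
    intervalIntegral.integral_of_le Real.two_pi_pos.le, integral_Ioc_eq_integral_Ioo,
    integral_Ioc_eq_integral_Ioo]
  congr 1
  refine setIntegral_congr_fun measurableSet_Ioo fun x hx => ?_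
  rw [W_eq, weight_eq_on_Ioo _ _ hx, ← mul_assoc, ← Complex.exp_add]
  congr 2
  ring

/-- A `2π`-periodic function on the line as a function on the circle. -/
noncomputable abbrev circleLift {F : ℝ → ℂ} (hF : Function.Periodic F (2 * Real.pi)) :
    AddCircle (2 * Real.pi) → ℂ := hF.lift

lemma integrable_circleLift {F : ℝ → ℂ} (hF : Function.Periodic F (2 * Real.pi))
    (hm : Measurable F) (hi : IntervalIntegrable F volume 0 (2 * Real.pi)) :
    Integrable (circleLift hF) (haarAddCircle (T := 2 * Real.pi)) := by
  rw [← memLp_one_iff_integrable, memLp_haarAddCircle_iff, memLp_one_iff_integrable]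
  have hmeas : Measurable (circleLift hF) := by
    have : circleLift hF = F ∘ Subtype.val ∘ measurableEquivIoc (2 * Real.pi) 0 := by
      ext x
      obtain ⟨y, rfl⟩ := (measurableEquivIoc (2 * Real.pi) 0).symm.surjective x
      simp only [Function.comp_apply, MeasurableEquiv.apply_symm_apply]
      exact hF.lift_coe _
    rw [this]
    exact hm.comp (measurable_subtype_coe.comp (measurableEquivIoc _ _).measurable)
  have hmp := AddCircle.measurePreserving_mk (2 * Real.pi) 0
  rw [intervalIntegrable_iff_integrableOn_Ioc_of_le Real.two_pi_pos.le] at hi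
  refine (hmp.integrable_comp hmeas.aestronglyMeasurable).1 ?_
  rw [zero_add]
  exact hi

lemma fourierTransform_eq_fourierCoeff {F : ℝ → ℂ} (hF : Function.Periodic F (2 * Real.pi))
    (j : ℤ) : fourierTransform F j = fourierCoeff (circleLift hF) j := by
  have hpi : (Real.pi : ℂ) ≠ 0 := by exact_mod_cast Real.pi_ne_zero
  rw [fourierCoeff_eq_intervalIntegral _ _ 0, fourierTransform, zero_add, Complex.real_smul]
  congr 1
  · push_cast; rfl
  · congr 1
    ext x
    rw [fourier_coe_apply, smul_eq_mul, circleLift, hF.lift_coe]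
    congr 2
    push_cast
    field_simp

lemma haarAddCircle_singleton (x : AddCircle (2 * Real.pi)) :
    haarAddCircle (T := 2 * Real.pi) {x} = 0 := by
  have h := volume_closedBall (2 * Real.pi) (x := x) 0
  rw [Metric.closedBall_zero, volume_eq_smul_haarAddCircle] at h
  have h0 : min (2 * Real.pi) (2 * 0) = 0 := by
    rw [mul_zero]; exact min_eq_right Real.two_pi_pos.le
  rw [h0, ENNReal.ofReal_zero, Measure.smul_apply, smul_eq_mul, mul_eq_zero] at h
  exact h.resolve_left (by simp [Real.pi_pos])

/-- The star-triangle equation excludes coinciding points; these form a null set of the torus. -/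
lemma ae_generic : ∀ᵐ z ∂((haarAddCircle (T := 2 * Real.pi)).prod haarAddCircle),
    z.1 ≠ 0 ∧ z.2 ≠ 0 ∧ z.1 - z.2 ≠ 0 := by
  have h0 : ∀ᵐ x ∂(haarAddCircle (T := 2 * Real.pi)), x ≠ 0 := by
    rw [ae_iff]
    simp [haarAddCircle_singleton]
  filter_upwards [Measure.quasiMeasurePreserving_fst.ae h0,
    Measure.quasiMeasurePreserving_snd.ae h0,
    (quasiMeasurePreserving_sub haarAddCircle haarAddCircle).ae h0] with z h1 h2 h3
  exact ⟨h1, h2, h3⟩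

lemma ne_two_pi_mul_of_coe_ne_zero {x : ℝ} (h : (x : AddCircle (2 * Real.pi)) ≠ 0) (n : ℤ) :
    x ≠ 2 * Real.pi * n := by
  intro hx
  refine h ((AddCircle.coe_eq_zero_iff _).2 ⟨n, ?_⟩)
  rw [hx, zsmul_eq_mul, mul_comm]

variable {p q r : Rapidity k k'}

/-- `hasSum_dual` is applied with `m = b - c` and `n = a - b`; its summation index is `e = b - d`.
-/
lemma dual_star_triangle (hk : k ^ 2 + k' ^ 2 = 1) (hk' : k' ≠ 0)
    (hpq : 0 < (q.lam - p.lam).re) (hqr : 0 < (r.lam - q.lam).re)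
    (hpr : (r.lam - p.lam).re < 1) (a b c : ℤ) :
    HasSum (fun d : ℤ => fourierTransform (W p q) (b - d) * fourierTransform (Wbar p r) (a - d) *
        fourierTransform (W q r) (d - c))
      (1 / Rinf p q r * (fourierTransform (Wbar q r) (a - b) * fourierTransform (W p r) (b - c) *
        fourierTransform (Wbar p q) (a - c))) := by
  have hpq1 : (q.lam - p.lam).re < 1 := by simp only [Complex.sub_re] at *; linarith
  have hqr1 : (r.lam - q.lam).re < 1 := by simp only [Complex.sub_re] at *; linarith
  have hpr0 : 0 < (r.lam - p.lam).re := by simp only [Complex.sub_re] at *; linarith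
  have iW : ∀ {p q : Rapidity k k'}, 0 < (q.lam - p.lam).re → (q.lam - p.lam).re < 1 →
      Integrable (circleLift (W_periodic p q)) (haarAddCircle (T := 2 * Real.pi)) :=
    fun h0 h1 => integrable_circleLift _ (measurable_weight _ _) (intervalIntegrable_W h0 h1)
  have iWbar : ∀ {p q : Rapidity k k'}, 0 < (q.lam - p.lam).re → (q.lam - p.lam).re < 1 →
      Integrable (circleLift (Wbar_periodic p q)) (haarAddCircle (T := 2 * Real.pi)) :=
    fun h0 h1 => integrable_circleLift _ (measurable_weight _ _) (intervalIntegrable_Wbar h0 h1)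
  have hsum : Summable fun e : ℤ => fourierCoeff (circleLift (W_periodic p q)) e *
      fourierCoeff (circleLift (W_periodic q r)) (b - c - e) := by
    simp only [← fourierTransform_eq_fourierCoeff, fourierTransform_W]
    -- The exponents add up to `λ_p - λ_r`, so the summability condition is `hpr`.
    have := (summable_chordIntegral_mul (s := p.lam - q.lam) (t := q.lam - r.lam)
      (by simp only [Complex.sub_re] at *; linarith) (by simp only [Complex.sub_re] at *; linarith)
      (by simp only [Complex.sub_re] at *; linarith) (by simp only [Complex.sub_re] at *; linarith)
      (by simp only [Complex.sub_re] at *; linarith) ((p.γ - q.γ) / (2 * Real.pi))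
      ((q.γ - r.γ) / (2 * Real.pi) - Complex.I * (b - c))).mul_left
      (1 / (2 * Real.pi) * (1 / (2 * Real.pi)) : ℂ)
    refine this.congr fun e => ?_
    rw [show (q.γ - r.γ) / (2 * Real.pi) - Complex.I * ((b - c - e : ℤ) : ℂ) =
      (q.γ - r.γ) / (2 * Real.pi) - Complex.I * (b - c) + Complex.I * e by push_cast; ring]
    ring
  have hstar : ∀ᵐ z ∂((haarAddCircle (T := 2 * Real.pi)).prod haarAddCircle),
      ∫ w, circleLift (Wbar_periodic q r) (z.2 - w) * circleLift (W_periodic p r) (z.1 - w) *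
        circleLift (Wbar_periodic p q) w ∂haarAddCircle =
      Rinf p q r * (circleLift (W_periodic p q) (z.1 - z.2) * circleLift (Wbar_periodic p r) z.2 *
        circleLift (W_periodic q r) z.1) := by
    filter_upwards [ae_generic] with z hz
    obtain ⟨u, v⟩ := z
    obtain ⟨x, rfl⟩ := QuotientAddGroup.mk_surjective u
    obtain ⟨y, rfl⟩ := QuotientAddGroup.mk_surjective v
    obtain ⟨h1, h2, h3⟩ := hz
    have key := (star_triangle hk hk' hpq hqr hpr (x := x) (y := y) (z := 0)
      (ne_two_pi_mul_of_coe_ne_zero h3) (by simpa using ne_two_pi_mul_of_coe_ne_zero h2)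
      (by simpa using ne_two_pi_mul_of_coe_ne_zero h1)).2
    simp only [sub_zero] at key
    rw [integral_haarAddCircle, ← AddCircle.intervalIntegral_preimage _ 0, zero_add,
      Complex.real_smul]
    rw [one_div] at key
    push_cast
    exact key
  have key := hasSum_dual (iW hpq hpq1) (iWbar hpr0 hpr) (iW hqr hqr1) (iWbar hqr hqr1)
    (iW hpr0 hpr) (iWbar hpq hpq1) (Rinf_ne_zero hk hk' hpq hqr hpr) hstar (b - c) (a - b) hsum
  simp only [← fourierTransform_eq_fourierCoeff] at key
  rw [← (Equiv.subLeft b).hasSum_iff] at key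
  convert key using 1
  · ext d
    simp only [Function.comp_apply, Equiv.subLeft_apply]
    rw [show a - b + (b - d) = a - d by ring, show b - c - (b - d) = d - c by ring]
  · congr 2
    congr 1
    ring

end Weights
end ChiralPotts

theorem mainTheorem3 (k k' : ℂ) (hk : k ^ 2 + k' ^ 2 = 1) (hk' : k' ≠ 0)
    (p q r : ChiralPotts.Rapidity k k')
    (hpq : 0 < (q.lam - p.lam).re) (hqr : 0 < (r.lam - q.lam).re)
    (hpr : (r.lam - p.lam).re < 1) :
    -- the six weights are `2π`-periodic and integrable over a period
    (∀ s ∈ ({(p, q), (q, r), (p, r)} :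
        Set (ChiralPotts.Rapidity k k' × ChiralPotts.Rapidity k k')),
      Function.Periodic (ChiralPotts.W s.1 s.2) (2 * Real.pi) ∧
      Function.Periodic (ChiralPotts.Wbar s.1 s.2) (2 * Real.pi) ∧
      IntervalIntegrable (ChiralPotts.W s.1 s.2) volume 0 (2 * Real.pi) ∧
      IntervalIntegrable (ChiralPotts.Wbar s.1 s.2) volume 0 (2 * Real.pi)) ∧
    ChiralPotts.Rinf p q r ≠ 0 ∧
    -- the star-triangle equation
    (∀ x y z : ℝ, (∀ n : ℤ, x - y ≠ 2 * Real.pi * n) → (∀ n : ℤ, y - z ≠ 2 * Real.pi * n) →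
      (∀ n : ℤ, x - z ≠ 2 * Real.pi * n) →
      IntervalIntegrable (fun w : ℝ => ChiralPotts.Wbar q r (y - w) * ChiralPotts.W p r (x - w) *
        ChiralPotts.Wbar p q (w - z)) volume 0 (2 * Real.pi) ∧
      (1 / (2 * Real.pi) : ℂ) * (∫ w in (0 : ℝ)..(2 * Real.pi),
        ChiralPotts.Wbar q r (y - w) * ChiralPotts.W p r (x - w) * ChiralPotts.Wbar p q (w - z)) =
      ChiralPotts.Rinf p q r *
        (ChiralPotts.W p q (x - y) * ChiralPotts.Wbar p r (y - z) * ChiralPotts.W q r (x - z))) ∧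
    -- the dual star-triangle equation
    (∀ a b c : ℤ,
      HasSum (fun d : ℤ =>
        ChiralPotts.fourierTransform (ChiralPotts.W p q) (b - d) *
        ChiralPotts.fourierTransform (ChiralPotts.Wbar p r) (a - d) *
        ChiralPotts.fourierTransform (ChiralPotts.W q r) (d - c))
      (1 / ChiralPotts.Rinf p q r *
        (ChiralPotts.fourierTransform (ChiralPotts.Wbar q r) (a - b) *
        ChiralPotts.fourierTransform (ChiralPotts.W p r) (b - c) *
        ChiralPotts.fourierTransform (ChiralPotts.Wbar p q) (a - c)))) := by
  have hpq1 : (q.lam - p.lam).re < 1 := by simp only [Complex.sub_re] at *; linarith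
  have hqr1 : (r.lam - q.lam).re < 1 := by simp only [Complex.sub_re] at *; linarith
  have hpr0 : 0 < (r.lam - p.lam).re := by simp only [Complex.sub_re] at *; linarith
  refine ⟨?_, ChiralPotts.Rinf_ne_zero hk hk' hpq hqr hpr,
    fun x y z hxy hyz hxz => ChiralPotts.star_triangle hk hk' hpq hqr hpr hxy hyz hxz,
    ChiralPotts.dual_star_triangle hk hk' hpq hqr hpr⟩
  rintro s (rfl | rfl | rfl)
  · exact ⟨ChiralPotts.W_periodic _ _, ChiralPotts.Wbar_periodic _ _,
      ChiralPotts.intervalIntegrable_W hpq hpq1, ChiralPotts.intervalIntegrable_Wbar hpq hpq1⟩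
  · exact ⟨ChiralPotts.W_periodic _ _, ChiralPotts.Wbar_periodic _ _,
      ChiralPotts.intervalIntegrable_W hqr hqr1, ChiralPotts.intervalIntegrable_Wbar hqr hqr1⟩
  · exact ⟨ChiralPotts.W_periodic _ _, ChiralPotts.Wbar_periodic _ _,
      ChiralPotts.intervalIntegrable_W hpr0 hpr, ChiralPotts.intervalIntegrable_Wbar hpr0 hpr⟩
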